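/- Let $\Omega$ be the category of (non-empty, finite, rooted) trees: its morphisms $S\to T$ are the morphisms $\Omega(S)\to\Omega(T)$ of symmetric coloured operads, where $\Omega(T)$ is the operad freely generated by the vertices of $T$, with the edges of $T$ as colours. Let $|T|$ be the number of vertices of $T$. A planar structure on $T$ is a linear order on the set of inputs of each vertex; the planar structures form a presheaf $P$ on $\Omega$, where for $f\colon S\to T$ and $p\in P(T)$ the inputs of a vertex of $S$ are ordered as their images, which are leaves of a subtree of $T$, are ordered from left to right by $p$. A planar structure $p$ labels the vertices of $T$ by $0,\dots,|T|-1$: the root vertex gets the label $0$, and after a vertex one labels all vertices of its first (leftmost) branch, then all those of its second branch, and so on, recursively. For $p,p'\in P(T)$ let $\mathrm{sgn}(p',p)\in\{\pm1\}$ be the sign of the permutation of the labels that takes the $p'$-label of each vertex to its $p$-label. The elementary faces $\partial_f\colon\partial_fT\to T$ are: the inner faces $\partial_e$, contracting an inner edge $e$; the top faces $\partial_w$, chopping off a vertex $w$ all of whose inputs are leaves, together with its inputs; and the bottom faces $\partial_{v,e}$, for the root vertex $v$ and an input $e$ of $v$ all of whose other inputs are leaves, chopping off $v$ with the root and all inputs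 of $v$ except $e$. Put $\mathrm{sgn}_p(\partial_e)=(-1)^k$ if $e$ is an inner edge and the vertex above $e$ has the label $k$, $\mathrm{sgn}_p(\partial_w)=(-1)^{k+1}$ if $w$ is a top vertex with the label $k$, and $\mathrm{sgn}_p(\partial_{v,e})=1$. (So for a corolla the inclusion of the root has the sign $-1$ and the inclusion of a leaf has the sign $+1$.) Let $X$ be a dendroidal set, i.e. a presheaf of sets on $\Omega$. For $n\ge 0$ let $Ch^{un}(X)_n$ be the quotient of the free abelian group on all triples $(T,p,x)$ with $T$ a tree, $|T|=n$, $p\in P(T)$ and $x\in X_T$, by the subgroup generated by all elements $$(T,p,x)-\mathrm{sgn}(p',\tau^*p)\,(T',p',\tau^*x)$$ for isomorphisms $\tau\colon T'\to T$, $p\in P(T)$, $p'\in P(T')$, $x\in X_T$. Write $[T,p,x]$ for the class of $(T,p,x)$. Let $D(X)_n\subseteq Ch^{un}(X)_n$ be the subgroup generated by the classes $[T,p,x]$ with $x$ degenerate, i.e. in the image of $\sigma^*$ for an elementary degeneracy map $\sigma$ with source $T$ (up to isomorphism, a map $\sigma_eS\to S$, where $\sigma_eS$ arises from $S$ by adding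 a copy $e'$ of an edge $e$ and a unary vertex between $e'$ and $e$). **Proposition.** There are unique homomorphisms $d\colon Ch^{un}(X)_{n+1}\to Ch^{un}(X)_{n}$, $n\ge0$, with $$d[T,p,x]=\sum_{\partial_f\colon\partial_fT\to T}\mathrm{sgn}_p(\partial_f)\,[\partial_fT,\ \partial_f^*p,\ \partial_f^*x]$$ for all $(T,p,x)$ with $|T|=n+1$, where the sum is over the set of elementary face maps of $T$. They satisfy $d\circ d=0$, so that $(Ch^{un}(X),d)$ is a chain complex, and $d(D(X)_{n+1})\subseteq D(X)_n$ for all $n\ge 0$, so that the degenerate dendrices generate a subcomplex. -/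

import Mathlib

universe u

namespace Dendroidal

open CategoryTheory

/-! ### Symmetric coloured operads -/

/-- A symmetric coloured operad in sets. Operations are indexed by a finite set `I` of inputs,
a colouring `c : I → Col` of the inputs and an output colour `c₀`; `reindex` is the action of
bijections of the index sets (in particular, of the symmetric groups), `one` are the identity
operations and `comp` is the full operadic composition. -/
structure ColouredOperad where
  Col : Type
  Op : (I : Type) → [Finite I] → (I → Col) → Col → Type
  one : (c : Col) → Op Unit (fun _ => c) c
  comp : {I : Type} → [Finite I] → {J : I → Type} → [∀ i, Finite (J i)] →
    {c : I → Col} → {c₀ : Col} → {d : (i : I) → J i → Col} →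
    Op I c c₀ → ((i : I) → Op (J i) (d i) (c i)) → Op (Σ i, J i) (fun k => d k.1 k.2) c₀
  reindex : {I J : Type} → [Finite I] → [Finite J] → (σ : I ≃ J) →
    {c : J → Col} → {c₀ : Col} → Op J c c₀ → Op I (fun i => c (σ i)) c₀
  reindex_refl : ∀ {I : Type} [Finite I] {c : I → Col} {c₀ : Col} (x : Op I c c₀),
    reindex (Equiv.refl I) x = x
  reindex_trans : ∀ {I J K : Type} [Finite I] [Finite J] [Finite K] (σ : I ≃ J) (τ : J ≃ K)
    {c : K → Col} {c₀ : Col} (x : Op K c c₀),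
    reindex (σ.trans τ) x = reindex σ (reindex τ x)
  comp_reindex_left : ∀ {I I' : Type} [Finite I] [Finite I'] (σ : I' ≃ I) {J : I → Type}
    [∀ i, Finite (J i)] {c : I → Col} {c₀ : Col} {d : (i : I) → J i → Col}
    (x : Op I c c₀) (y : (i : I) → Op (J i) (d i) (c i)),
    comp (reindex σ x) (fun i => y (σ i)) =
      reindex (Equiv.sigmaCongrLeft (β := J) σ) (comp x y)
  comp_reindex_right : ∀ {I : Type} [Finite I] {J J' : I → Type} [∀ i, Finite (J i)]
    [∀ i, Finite (J' i)] (τ : ∀ i, J' i ≃ J i) {c : I → Col} {c₀ : Col}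
    {d : (i : I) → J i → Col} (x : Op I c c₀) (y : (i : I) → Op (J i) (d i) (c i)),
    comp x (fun i => reindex (τ i) (y i)) = reindex (Equiv.sigmaCongrRight τ) (comp x y)
  one_comp : ∀ {J : Type} [Finite J] {c₀ : Col} {d : J → Col} (y : Op J d c₀),
    comp (J := fun _ => J) (d := fun _ => d) (one c₀) (fun _ => y) =
      reindex (⟨fun k => k.2, fun j => ⟨(), j⟩, fun _ => rfl, fun _ => rfl⟩ :
        (Σ _ : Unit, J) ≃ J) y
  comp_one : ∀ {I : Type} [Finite I] {c : I → Col} {c₀ : Col} (x : Op I c c₀),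
    comp x (fun i => one (c i)) = reindex (Equiv.sigmaPUnit I) x
  assoc : ∀ {I : Type} [Finite I] {J : I → Type} [∀ i, Finite (J i)]
    {K : (i : I) → J i → Type} [∀ i j, Finite (K i j)] {c : I → Col} {c₀ : Col}
    {d : (i : I) → J i → Col} {b : (i : I) → (j : J i) → K i j → Col}
    (x : Op I c c₀) (y : (i : I) → Op (J i) (d i) (c i))
    (z : (i : I) → (j : J i) → Op (K i j) (b i j) (d i j)),
    comp (comp x y) (fun k => z k.1 k.2) =
      reindex (Equiv.sigmaAssoc K) (comp x (fun i => comp (y i) (z i)))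

/-- A morphism of symmetric coloured operads. -/
structure ColouredOperad.Hom (P Q : ColouredOperad) where
  col : P.Col → Q.Col
  op : {I : Type} → [Finite I] → {c : I → P.Col} → {c₀ : P.Col} →
    P.Op I c c₀ → Q.Op I (fun i => col (c i)) (col c₀)
  op_one : ∀ c, op (P.one c) = Q.one (col c)
  op_comp : ∀ {I : Type} [Finite I] {J : I → Type} [∀ i, Finite (J i)]
    {c : I → P.Col} {c₀ : P.Col} {d : (i : I) → J i → P.Col}
    (x : P.Op I c c₀) (y : (i : I) → P.Op (J i) (d i) (c i)),
    op (P.comp x y) = Q.comp (op x) (fun i => op (y i))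
  op_reindex : ∀ {I J : Type} [Finite I] [Finite J] (σ : I ≃ J) {c : J → P.Col} {c₀ : P.Col}
    (x : P.Op J c c₀), op (P.reindex σ x) = Q.reindex σ (op x)

/-- The identity morphism. -/
def ColouredOperad.Hom.id (P : ColouredOperad) : ColouredOperad.Hom P P where
  col c := c
  op x := x
  op_one _ := rfl
  op_comp _ _ := rfl
  op_reindex := by intros; rfl

/-- The composition of morphisms. -/
def ColouredOperad.Hom.comp {P Q R : ColouredOperad} (f : ColouredOperad.Hom P Q)
    (g : ColouredOperad.Hom Q R) : ColouredOperad.Hom P R where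
  col c := g.col (f.col c)
  op x := g.op (f.op x)
  op_one c := by rw [f.op_one, g.op_one]
  op_comp x y := by rw [f.op_comp, g.op_comp]
  op_reindex := by
    intros
    rw [f.op_reindex, g.op_reindex]

/-- Symmetric coloured operads form a category. -/
instance : Category ColouredOperad where
  Hom := ColouredOperad.Hom
  id := ColouredOperad.Hom.id
  comp := ColouredOperad.Hom.comp

/-! ### Trees -/

/-- A non-empty finite rooted tree: finitely many edges and vertices, each vertex has an output
edge and a (possibly empty) set of input edges, each edge is the output of at most one vertex and
an input of at most one vertex, the root is the unique edge which is not an input of a vertex,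
and from each edge one gets down to the root by passing from an input of a vertex to its output.
(The set of vertices is finite since `out` is injective.) -/
structure Tree where
  Edge : Type
  Vert : Type
  finite_edge : Finite Edge
  root : Edge
  out : Vert → Edge
  ins : Vert → Set Edge
  out_inj : ∀ {v w : Vert}, out v = out w → v = w
  ins_unique : ∀ {v w : Vert} {a : Edge}, a ∈ ins v → a ∈ ins w → v = w
  exists_ins_iff : ∀ a : Edge, (∃ v, a ∈ ins v) ↔ a ≠ root
  connected : ∀ a : Edge, Relation.ReflTransGen (fun b c => ∃ v, b ∈ ins v ∧ out v = c) a root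

namespace Tree

variable (T : Tree)

instance : Finite T.Edge := T.finite_edge

instance : Finite T.Vert := Finite.of_injective T.out (fun _ _ h => T.out_inj h)

/-- The number `|T|` of vertices. -/
noncomputable def size : ℕ := Nat.card T.Vert

/-- `T.Step b c`: `b` is an input and `c` is the output of some vertex. -/
def Step (b c : T.Edge) : Prop := ∃ v, b ∈ T.ins v ∧ T.out v = c

/-- `T.Below a b`: the edge `a` lies on the path from the edge `b` down to the root
(including `a = b`). -/
def Below (a b : T.Edge) : Prop := Relation.ReflTransGen T.Step b a

/-- An edge is a leaf if it is not the output of a vertex. -/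
def IsLeaf (a : T.Edge) : Prop := ∀ u, T.out u ≠ a

variable {T}

theorem not_step_root {b : T.Edge} : ¬ T.Step T.root b := fun ⟨v, hv, _⟩ =>
  (T.exists_ins_iff _).1 ⟨v, hv⟩ rfl

theorem step_unique {a b c : T.Edge} (h : T.Step a b) (h' : T.Step a c) : b = c := by
  obtain ⟨v, hv, rfl⟩ := h
  obtain ⟨w, hw, rfl⟩ := h'
  rw [T.ins_unique hv hw]

theorem below_refl (a : T.Edge) : T.Below a a := Relation.ReflTransGen.refl

theorem below_trans {a b c : T.Edge} (h : T.Below a b) (h' : T.Below b c) : T.Below a c :=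
  Relation.ReflTransGen.trans h' h

theorem root_below (a : T.Edge) : T.Below T.root a := T.connected a

theorem out_below {v : T.Vert} {a : T.Edge} (h : a ∈ T.ins v) : T.Below (T.out v) a :=
  Relation.ReflTransGen.single ⟨v, h, rfl⟩

theorem not_transGen (a : T.Edge) : ¬ Relation.TransGen T.Step a a := by
  refine Relation.ReflTransGen.head_induction_on (motive := fun b _ =>
    ¬ Relation.TransGen T.Step b b) (T.connected a) ?_ ?_
  · intro h
    obtain ⟨c, hc, -⟩ := Relation.TransGen.head'_iff.1 h
    exact not_step_root hc
  · intro b c hbc _ ih h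
    obtain ⟨c', hc, h'⟩ := Relation.TransGen.head'_iff.1 h
    obtain rfl := step_unique hbc hc
    exact ih (Relation.TransGen.tail' h' hbc)

theorem below_antisymm {a b : T.Edge} (h : T.Below a b) (h' : T.Below b a) : a = b := by
  rcases Relation.reflTransGen_iff_eq_or_transGen.1 h with h1 | h1
  · exact h1
  · exact absurd (Relation.TransGen.trans_left h1 h') (not_transGen b)

theorem below_total {a b c : T.Edge} (h : T.Below a c) (h' : T.Below b c) :
    T.Below a b ∨ T.Below b a :=
  (Relation.ReflTransGen.total_of_right_unique (r := T.Step)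
    (fun _ _ _ => step_unique) h h').symm

theorem below_out_of_ne {a b : T.Edge} {v : T.Vert} (h : T.Below a b) (hb : b ∈ T.ins v)
    (hne : a ≠ b) : T.Below a (T.out v) := by
  rcases Relation.ReflTransGen.cases_head h with h1 | ⟨c, hc, h1⟩
  · exact absurd h1.symm hne
  · rwa [step_unique (⟨v, hb, rfl⟩ : T.Step b (T.out v)) hc]

theorem not_below_out {a : T.Edge} {v : T.Vert} (h : a ∈ T.ins v) : ¬ T.Below a (T.out v) :=
  fun h' => not_transGen a (Relation.TransGen.head' ⟨v, h, rfl⟩ h')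

theorem out_notMem_ins (v : T.Vert) : T.out v ∉ T.ins v :=
  fun h => not_below_out h (below_refl _)

theorem siblings_incomparable {v : T.Vert} {i j : T.Edge} (hi : i ∈ T.ins v)
    (hj : j ∈ T.ins v) (h : T.Below i j) : i = j := by
  by_contra hne
  exact not_below_out hi (below_out_of_ne h hj hne)

/-! ### The operad generated by a tree -/

/-- `T.Gen c e`: the vertices of `T` generate an operation with inputs `c` and output `e`. -/
inductive Gen (T : Tree) : (I : Type) → [Finite I] → (I → T.Edge) → T.Edge → Prop
  | one (e : T.Edge) : Gen T Unit (fun _ => e) e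
  | vertex (v : T.Vert) : Gen T (T.ins v) (fun a => a.1) (T.out v)
  | comp {I : Type} [Finite I] {J : I → Type} [∀ i, Finite (J i)] {c : I → T.Edge}
      {c₀ : T.Edge} {d : (i : I) → J i → T.Edge} (hx : Gen T I c c₀)
      (hy : ∀ i, Gen T (J i) (d i) (c i)) : Gen T (Σ i, J i) (fun k => d k.1 k.2) c₀
  | reindex {I J : Type} [Finite I] [Finite J] (σ : I ≃ J) {c : J → T.Edge} {c₀ : T.Edge}
      (hx : Gen T J c c₀) : Gen T I (fun i => c (σ i)) c₀

/-- The symmetric coloured operad `Ω(T)` freely generated by the vertices of `T`. Its colours are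
the edges of `T`. For each signature there is at most one operation (given by the subtree with
the given leaves and the given root), so that the set of operations is the truth value of the
proposition that the vertices generate an operation of this signature. -/
def operad (T : Tree) : ColouredOperad where
  Col := T.Edge
  Op I _ c c₀ := PLift (T.Gen I c c₀)
  one c := ⟨Gen.one c⟩
  comp x y := ⟨Gen.comp x.down (fun i => (y i).down)⟩
  reindex σ _ _ x := ⟨Gen.reindex σ x.down⟩
  reindex_refl _ := rfl
  reindex_trans _ _ _ _ _ := rfl
  comp_reindex_left := by intros; rfl
  comp_reindex_right := by intros; rfl
  one_comp _ := rfl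
  comp_one _ := rfl
  assoc _ _ _ := rfl

/-- The category `Ω` of trees, as a full subcategory of the category of coloured operads. -/
instance : Category Tree where
  Hom S T := ColouredOperad.Hom S.operad T.operad
  id T := ColouredOperad.Hom.id T.operad
  comp f g := ColouredOperad.Hom.comp f g

/-- The map on edges underlying a morphism of trees. -/
def edgeMap {S T : Tree} (f : S ⟶ T) : S.Edge → T.Edge := ColouredOperad.Hom.col f

@[simp] theorem edgeMap_id (T : Tree) (a : T.Edge) : edgeMap (𝟙 T) a = a := rfl

@[simp] theorem edgeMap_comp {R S T : Tree} (f : R ⟶ S) (g : S ⟶ T) (a : R.Edge) :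
    edgeMap (f ≫ g) a = edgeMap g (edgeMap f a) := rfl

theorem gen_map {S T : Tree} (f : S ⟶ T) {I : Type} [Finite I] {c : I → S.Edge} {e : S.Edge}
    (h : S.Gen I c e) : T.Gen I (fun i => edgeMap f (c i)) (edgeMap f e) :=
  (ColouredOperad.Hom.op f (PLift.up h)).down

/-- A morphism of trees is determined by its map on edges. -/
theorem hom_ext {S T : Tree} {f g : S ⟶ T} (h : ∀ a, edgeMap f a = edgeMap g a) : f = g := by
  obtain ⟨f, f', _, _, _⟩ := f
  obtain ⟨g, g', _, _, _⟩ := g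
  obtain rfl : f = g := funext h
  obtain rfl : @f' = @g' := by
    funext I _ c c₀ x
    exact congrArg PLift.up (Subsingleton.elim (f' x).down (g' x).down)
  rfl

/-- A morphism of trees given by a map on edges which sends each vertex of `S` to an operation
of the operad of `T`. -/
def homMk {S T : Tree} (f : S.Edge → T.Edge)
    (h : ∀ v, T.Gen (S.ins v) (fun a => f a.1) (f (S.out v))) : S ⟶ T :=
  have key : ∀ {I : Type} [Finite I] {c : I → S.Edge} {e : S.Edge}, S.Gen I c e →
      T.Gen I (fun i => f (c i)) (f e) := by
    intro I _ c e hg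
    induction hg with
    | one e => exact Gen.one _
    | vertex v => exact h v
    | comp _ _ ihx ihy => exact Gen.comp ihx ihy
    | reindex σ _ ih => exact Gen.reindex σ ih
  (⟨f, fun x => ⟨key x.down⟩, fun _ => rfl, fun _ _ => rfl, by intros; rfl⟩ :
    ColouredOperad.Hom S.operad T.operad)

@[simp] theorem edgeMap_homMk {S T : Tree} (f : S.Edge → T.Edge)
    (h : ∀ v, T.Gen (S.ins v) (fun a => f a.1) (f (S.out v))) (a : S.Edge) :
    edgeMap (homMk f h) a = f a := rfl

theorem Gen.of_equiv {T : Tree} {I J : Type} [Finite I] [Finite J] {c : I → T.Edge}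
    {d : J → T.Edge} {e e' : T.Edge} (h : T.Gen J d e) (σ : I ≃ J) (hc : ∀ i, c i = d (σ i))
    (he : e' = e) : T.Gen I c e' := by
  obtain rfl : c = fun i => d (σ i) := funext hc
  subst he
  exact Gen.reindex σ h

theorem Gen.of_bijective {T : Tree} {I J : Type} [Finite I] [Finite J] {c : I → T.Edge}
    {d : J → T.Edge} {e : T.Edge} (h : T.Gen J d e) (s : J → I) (hs : Function.Bijective s)
    (hc : ∀ j, c (s j) = d j) : T.Gen I c e := by
  refine h.of_equiv (Equiv.ofBijective s hs).symm (fun i => ?_) rfl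
  obtain ⟨j, rfl⟩ := hs.2 i
  rw [hc, Equiv.ofBijective_symm_apply_apply]

theorem Gen.below_inputs {T : Tree} {I : Type} [Finite I] {c : I → T.Edge} {e : T.Edge}
    (h : T.Gen I c e) : ∀ i, T.Below e (c i) := by
  induction h with
  | one e => exact fun _ => below_refl e
  | vertex v => exact fun a => out_below a.2
  | comp _ _ ihx ihy => exact fun k => below_trans (ihx k.1) (ihy k.1 k.2)
  | reindex σ _ ih => exact fun i => ih (σ i)

theorem Gen.incomparable {T : Tree} {I : Type} [Finite I] {c : I → T.Edge} {e : T.Edge}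
    (h : T.Gen I c e) : ∀ i j, T.Below (c i) (c j) → i = j := by
  induction h with
  | one e => exact fun _ _ _ => rfl
  | vertex v => exact fun a b hab => Subtype.ext (siblings_incomparable a.2 b.2 hab)
  | comp hx hy ihx ihy =>
    rintro ⟨i, j⟩ ⟨i', j'⟩ hb
    have h1 := (hy i).below_inputs j
    have h2 := (hy i').below_inputs j'
    have : i = i' := by
      rcases below_total (below_trans h1 hb) h2 with h3 | h3
      · exact ihx _ _ h3
      · exact (ihx _ _ h3).symm
    subst this
    rw [ihy i j j' hb]
  | reindex σ _ ih => exact fun i j hb => σ.injective (ih _ _ hb)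

theorem edgeMap_below {S T : Tree} (f : S ⟶ T) {a b : S.Edge} (h : S.Below a b) :
    T.Below (edgeMap f a) (edgeMap f b) := by
  induction h with
  | refl => exact below_refl _
  | tail _ hs ih =>
    obtain ⟨v, hv, rfl⟩ := hs
    exact below_trans ((gen_map f (Gen.vertex v)).below_inputs ⟨_, hv⟩) ih

theorem edgeMap_incomparable {S T : Tree} (f : S ⟶ T) {v : S.Vert} {a b : S.Edge}
    (ha : a ∈ S.ins v) (hb : b ∈ S.ins v) (h : T.Below (edgeMap f a) (edgeMap f b)) : a = b :=
  congrArg Subtype.val ((gen_map f (Gen.vertex v)).incomparable ⟨a, ha⟩ ⟨b, hb⟩ h)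

end Tree

/-! ### Planar structures -/

/-- A planar structure on a tree: a (strict) linear order on the set of inputs of each vertex. -/
@[ext] structure Planar (T : Tree) where
  lt : (v : T.Vert) → T.ins v → T.ins v → Prop
  irrefl : ∀ v i, ¬ lt v i i
  trans : ∀ v i j k, lt v i j → lt v j k → lt v i k
  total : ∀ v i j, i ≠ j → lt v i j ∨ lt v j i

namespace Planar

variable {T : Tree} (p : Planar T)

/-- `p.Left a b`: the edge `a` lies to the left of the edge `b`, i.e. there are two inputs `i < j`
of some vertex such that `a` is in the branch starting with `i` and `b` in the branch starting
with `j`. -/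
def Left (a b : T.Edge) : Prop :=
  ∃ (v : T.Vert) (i j : T.ins v), p.lt v i j ∧ T.Below i a ∧ T.Below j b

variable {p}

theorem Left.mono {a b a' b' : T.Edge} (h : p.Left a b) (ha : T.Below a a') (hb : T.Below b b') :
    p.Left a' b' := by
  obtain ⟨v, i, j, hij, hi, hj⟩ := h
  exact ⟨v, i, j, hij, Tree.below_trans hi ha, Tree.below_trans hj hb⟩

theorem Left.not_below {a b : T.Edge} (h : p.Left a b) : ¬ T.Below a b ∧ ¬ T.Below b a := by
  obtain ⟨v, i, j, hij, hi, hj⟩ := h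
  have key : ∀ c, T.Below i c → T.Below j c → False := by
    intro c h1 h2
    have : i = j := by
      rcases Tree.below_total h1 h2 with h3 | h3
      · exact Subtype.ext (Tree.siblings_incomparable i.2 j.2 h3)
      · exact (Subtype.ext (Tree.siblings_incomparable j.2 i.2 h3)).symm
    exact p.irrefl v i (this ▸ hij)
  exact ⟨fun h => key b (Tree.below_trans hi h) hj, fun h => key a hi (Tree.below_trans hj h)⟩

theorem Left.trans {a b c : T.Edge} (h : p.Left a b) (h' : p.Left b c) : p.Left a c := by
  obtain ⟨v, i, j, hij, hi, hj⟩ := h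
  obtain ⟨w, k, l, hkl, hk, hl⟩ := h'
  by_cases hjk : j.1 = k.1
  · obtain rfl : v = w := T.ins_unique j.2 (hjk ▸ k.2)
    obtain rfl : j = k := Subtype.ext hjk
    exact ⟨v, i, l, p.trans v _ _ _ hij hkl, hi, hl⟩
  · rcases Tree.below_total hj hk with h1 | h1
    · refine ⟨v, i, j, hij, hi, ?_⟩
      exact Tree.below_trans (Tree.below_out_of_ne h1 k.2 hjk)
        (Tree.below_trans (Tree.out_below l.2) hl)
    · refine ⟨w, k, l, hkl, ?_, hl⟩
      exact Tree.below_trans (Tree.below_out_of_ne h1 j.2 (Ne.symm hjk))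
        (Tree.below_trans (Tree.out_below i.2) hi)

theorem Left.irrefl {a : T.Edge} : ¬ p.Left a a := fun h => h.not_below.1 (Tree.below_refl a)

theorem Left.asymm {a b : T.Edge} (h : p.Left a b) : ¬ p.Left b a :=
  fun h' => Left.irrefl (h.trans h')

variable (p) in
theorem left_total {a b : T.Edge} (hab : ¬ T.Below a b) (hba : ¬ T.Below b a) :
    p.Left a b ∨ p.Left b a := by
  have key : ∀ c, Relation.ReflTransGen T.Step c T.root → T.Below c a → ¬ T.Below c b →
      ∃ v, ∃ i ∈ T.ins v, T.Below i a ∧ ¬ T.Below i b ∧ T.Below (T.out v) b := by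
    intro c hc
    induction hc using Relation.ReflTransGen.head_induction_on with
    | refl => exact fun _ h => absurd (Tree.root_below b) h
    | @head x y hs _ ih =>
      intro h1 h2
      by_cases hy : T.Below y b
      · obtain ⟨v, hv, rfl⟩ := hs
        exact ⟨v, x, hv, h1, h2, hy⟩
      · exact ih (Tree.below_trans (Relation.ReflTransGen.single hs) h1) hy
  obtain ⟨v, i, hi, h1, h2, h3⟩ := key a (T.connected a) (Tree.below_refl a) hab
  rcases Relation.ReflTransGen.cases_tail h3 with h4 | ⟨j, hj, ⟨w, hw, hwv⟩⟩
  · exact absurd (h4 ▸ Tree.below_trans (Tree.out_below hi) h1) hba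
  · obtain rfl := T.out_inj hwv
    have hne : (⟨i, hi⟩ : T.ins w) ≠ ⟨j, hw⟩ := by
      intro h
      have h' : i = j := congrArg Subtype.val h
      exact h2 (h' ▸ hj)
    rcases p.total w _ _ hne with h | h
    · exact Or.inl ⟨w, _, _, h, h1, hj⟩
    · exact Or.inr ⟨w, _, _, h, hj, h1⟩

/-- The planar structure `P(f)(p)` on `S` induced by a planar structure `p` on `T` along a
morphism `f : S ⟶ T`: two inputs of a vertex of `S` are compared by comparing their images, which
are two leaves of the subtree of `T` corresponding to the vertex, in the left-to-right order. -/
def pullback {S T : Tree} (f : S ⟶ T) (p : Planar T) : Planar S where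
  lt _ i j := p.Left (Tree.edgeMap f i) (Tree.edgeMap f j)
  irrefl _ _ := Left.irrefl
  trans _ _ _ _ h h' := h.trans h'
  total _ i j hij := p.left_total
    (fun h => hij (Subtype.ext (Tree.edgeMap_incomparable f i.2 j.2 h)))
    (fun h => hij (Subtype.ext (Tree.edgeMap_incomparable f j.2 i.2 h)).symm)

theorem lt_iff_left (p : Planar T) (v : T.Vert) (i j : T.ins v) : p.lt v i j ↔ p.Left i j := by
  refine ⟨fun h => ⟨v, i, j, h, Tree.below_refl _, Tree.below_refl _⟩, fun h => ?_⟩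
  have hij : i ≠ j := fun h' => Left.irrefl (h' ▸ h)
  rcases p.total v i j hij with h1 | h1
  · exact h1
  · exact absurd ⟨v, j, i, h1, Tree.below_refl _, Tree.below_refl _⟩ h.asymm

theorem left_pullback {S T : Tree} (f : S ⟶ T) (p : Planar T) {a b : S.Edge}
    (h : (pullback f p).Left a b) : p.Left (Tree.edgeMap f a) (Tree.edgeMap f b) := by
  obtain ⟨v, i, j, hij, hi, hj⟩ := h
  exact Left.mono hij (Tree.edgeMap_below f hi) (Tree.edgeMap_below f hj)

theorem pullback_comp {R S T : Tree} (f : R ⟶ S) (g : S ⟶ T) (p : Planar T) :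
    pullback (f ≫ g) p = pullback f (pullback g p) := by
  ext v i j
  refine ⟨fun h => ?_, fun h => (left_pullback g p h : p.Left _ _)⟩
  replace h : p.Left (Tree.edgeMap g (Tree.edgeMap f i)) (Tree.edgeMap g (Tree.edgeMap f j)) := h
  have hij : i ≠ j := fun h' => Left.irrefl (h' ▸ h)
  rcases (pullback f (pullback g p)).total v i j hij with h1 | h1
  · exact h1
  · exact absurd (left_pullback g p h1) (Left.asymm h)

theorem pullback_id (p : Planar T) : pullback (𝟙 T) p = p := by
  ext v i j
  exact (p.lt_iff_left v i j).symm

/-! ### The labelling of the vertices -/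

variable (p)

/-- The order in which the vertices of a planar tree get labelled: first a vertex, then all the
vertices of its leftmost branch, then all those of the second branch, and so on. So `u` comes
before `w` iff `u` is below `w`, or `u` is in a branch to the left of a branch that has `w`. -/
def Before (u w : T.Vert) : Prop :=
  (u ≠ w ∧ T.Below (T.out u) (T.out w)) ∨ p.Left (T.out u) (T.out w)

/-- The label of a vertex: the number of vertices which are labelled before it. So the vertices
get the labels `0, …, |T| - 1`. -/
noncomputable def label (w : T.Vert) : ℕ := Nat.card {u : T.Vert // p.Before u w}

variable {p}

theorem Before.irrefl {u : T.Vert} : ¬ p.Before u u := by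
  rintro (⟨h, -⟩ | h)
  · exact h rfl
  · exact Left.irrefl h

theorem Before.trans {u v w : T.Vert} (h : p.Before u v) (h' : p.Before v w) :
    p.Before u w := by
  rcases h with ⟨hn, h⟩ | h <;> rcases h' with ⟨hn', h'⟩ | h'
  · refine Or.inl ⟨?_, Tree.below_trans h h'⟩
    rintro rfl
    exact hn (T.out_inj (Tree.below_antisymm h h'))
  · obtain ⟨x, i, j, hij, hi, hj⟩ := h'
    rcases Tree.below_total h hi with h1 | h1
    · by_cases hne : T.out u = i.1
      · exact Or.inr ⟨x, i, j, hij, hne ▸ Tree.below_refl _, hj⟩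
      · have h2 := Tree.below_trans (Tree.below_out_of_ne h1 i.2 hne)
          (Tree.below_trans (Tree.out_below j.2) hj)
        refine Or.inl ⟨?_, h2⟩
        rintro rfl
        exact (Left.not_below ⟨x, i, j, hij, hi, hj⟩).2 h
    · exact Or.inr ⟨x, i, j, hij, h1, hj⟩
  · exact Or.inr (h.mono (Tree.below_refl _) h')
  · exact Or.inr (h.trans h')

variable (p) in
theorem before_total {u w : T.Vert} (h : u ≠ w) : p.Before u w ∨ p.Before w u := by
  by_cases h1 : T.Below (T.out u) (T.out w)
  · exact Or.inl (Or.inl ⟨h, h1⟩)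
  by_cases h2 : T.Below (T.out w) (T.out u)
  · exact Or.inr (Or.inl ⟨h.symm, h2⟩)
  exact (p.left_total h1 h2).imp Or.inr Or.inr

theorem label_lt_label {u w : T.Vert} (h : p.Before u w) : p.label u < p.label w :=
  Set.ncard_lt_ncard (s := {x | p.Before x u}) (t := {x | p.Before x w})
    ⟨fun _ hx => Before.trans hx h, fun hs => Before.irrefl (hs h)⟩ (Set.toFinite _)

variable (p) in
theorem label_lt (w : T.Vert) : p.label w < T.size := by
  have h : ({x | p.Before x w} : Set T.Vert) ⊂ Set.univ :=
    ⟨Set.subset_univ _, fun hs => Before.irrefl (hs (Set.mem_univ w))⟩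
  have := Set.ncard_lt_ncard h (Set.toFinite _)
  rwa [Set.ncard_univ] at this

theorem label_injective : Function.Injective p.label := by
  intro u w h
  by_contra hne
  rcases p.before_total hne with h1 | h1
  · exact absurd h (label_lt_label h1).ne
  · exact absurd h (label_lt_label h1).ne'

variable (p)

/-- The labelling as a bijection between the vertices and the set of labels. -/
noncomputable def labelEquiv : T.Vert ≃ Fin T.size :=
  Equiv.ofBijective (fun w => ⟨p.label w, p.label_lt w⟩) <| by
    have hinj : Function.Injective (fun w => (⟨p.label w, p.label_lt w⟩ : Fin T.size)) :=
      fun u w h => label_injective (congrArg Fin.val h)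
    exact (Nat.bijective_iff_injective_and_card _).2 ⟨hinj, by simp [Tree.size]⟩

/-- The sign `sgn(p', p)`: the sign of the permutation of the set of labels which sends the
label of each vertex with respect to `p'` to its label with respect to `p`. (The label `0` of the
root vertex is always fixed, so that it does not matter whether it is included.) -/
noncomputable def sgn (p' p : Planar T) : ℤˣ :=
  Equiv.Perm.sign (p'.labelEquiv.symm.trans p.labelEquiv)

end Planar

/-! ### Elementary faces -/

namespace Tree

variable (T : Tree)

/-- The elementary faces of a tree:
* for each inner edge, i.e. an edge `out w` that is both the output of a vertex `w` and an input
  of a vertex `v`, an inner face;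
* for each top vertex `w`, i.e. a vertex all of whose inputs are leaves, a top face;
* for each bottom vertex `v` with an input `e` such that all other inputs of `v` are leaves,
  a bottom face. -/
inductive Face
  | inner (v w : T.Vert) (h : T.out w ∈ T.ins v)
  | top (w : T.Vert) (h : ∀ a ∈ T.ins w, T.IsLeaf a)
  | bottom (v : T.Vert) (e : T.Edge) (hv : T.out v = T.root) (he : e ∈ T.ins v)
      (h : ∀ a ∈ T.ins v, a ≠ e → T.IsLeaf a)

instance : Finite T.Face := by
  refine Finite.of_injective (β := (T.Vert × T.Vert) ⊕ T.Vert ⊕ (T.Vert × T.Edge))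
    (fun f => match f with
      | .inner v w _ => .inl (v, w)
      | .top w _ => .inr (.inl w)
      | .bottom v e _ _ _ => .inr (.inr (v, e))) ?_
  intro f g h
  cases f <;> cases g <;> simp_all

noncomputable instance : Fintype T.Face := Fintype.ofFinite _

variable {T}

/-- Contracting the inner edge `out w`: the vertices `v` and `w` are merged to a single vertex
(which is still called `v`), whose inputs are the inputs of `v` other than `out w` and the inputs
of `w`. -/
def innerFace (v w : T.Vert) (h : T.out w ∈ T.ins v) : Tree where
  Edge := {a : T.Edge // a ≠ T.out w}
  Vert := {u : T.Vert // u ≠ w}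
  finite_edge := inferInstance
  root := ⟨T.root, fun h' => (T.exists_ins_iff _).1 ⟨v, h⟩ h'.symm⟩
  out u := ⟨T.out u.1, fun h' => u.2 (T.out_inj h')⟩
  ins u := {a | a.1 ∈ T.ins u.1 ∨ (u.1 = v ∧ a.1 ∈ T.ins w)}
  out_inj h' := Subtype.ext (T.out_inj (congrArg Subtype.val h'))
  ins_unique := by
    rintro ⟨u, hu⟩ ⟨u', hu'⟩ ⟨a, ha⟩ h1 h2
    apply Subtype.ext
    rcases h1 with h1 | ⟨h1, h1'⟩ <;> rcases h2 with h2 | ⟨h2, h2'⟩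
    · exact T.ins_unique h1 h2
    · exact absurd (T.ins_unique h1 h2') hu
    · exact absurd (T.ins_unique h2 h1') hu'
    · exact h1.trans h2.symm
  exists_ins_iff := by
    rintro ⟨a, ha⟩
    rw [Ne, Subtype.mk.injEq, ← Ne, ← T.exists_ins_iff]
    constructor
    · rintro ⟨u, h1 | ⟨-, h1⟩⟩
      · exact ⟨_, h1⟩
      · exact ⟨_, h1⟩
    · rintro ⟨u, hu⟩
      by_cases huw : u = w
      · subst huw
        exact ⟨⟨v, fun h' => T.out_notMem_ins v (h' ▸ h)⟩, Or.inr ⟨rfl, hu⟩⟩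
      · exact ⟨⟨u, huw⟩, Or.inl hu⟩
  connected := by
    have hvw : v ≠ w := fun h' => T.out_notMem_ins v (h' ▸ h)
    rintro ⟨a, ha⟩
    suffices H : ∀ b, Relation.ReflTransGen T.Step b T.root → ∀ (c : {a : T.Edge // a ≠ T.out w}),
        (b = c.1 ∨ (b = T.out w ∧ c.1 = T.out v)) → Relation.ReflTransGen
        (fun (b c : {a : T.Edge // a ≠ T.out w}) => ∃ u : {u : T.Vert // u ≠ w},
          (b.1 ∈ T.ins u.1 ∨ (u.1 = v ∧ b.1 ∈ T.ins w)) ∧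
            (⟨T.out u.1, fun h' => u.2 (T.out_inj h')⟩ : {a : T.Edge // a ≠ T.out w}) = c) c
        ⟨T.root, fun h' => (T.exists_ins_iff _).1 ⟨v, h⟩ h'.symm⟩ from
      H a (T.connected a) ⟨a, ha⟩ (Or.inl rfl)
    intro b hb
    induction hb using Relation.ReflTransGen.head_induction_on with
    | refl =>
      rintro c (h1 | ⟨h1, -⟩)
      · obtain ⟨c, hc⟩ := c
        obtain rfl : T.root = c := h1
        exact Relation.ReflTransGen.refl
      · exact absurd h1.symm ((T.exists_ins_iff _).1 ⟨v, h⟩)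
    | @head x y hs _ ih =>
      obtain ⟨u, hu, rfl⟩ := hs
      rintro ⟨c, hc⟩ (h1 | ⟨h1, h2⟩)
      · obtain rfl : x = c := h1
        by_cases huw : u = w
        · subst huw
          exact Relation.ReflTransGen.head ⟨⟨v, hvw⟩, Or.inr ⟨rfl, hu⟩, rfl⟩
            (ih _ (Or.inr ⟨rfl, rfl⟩))
        · exact Relation.ReflTransGen.head ⟨⟨u, huw⟩, Or.inl hu, rfl⟩ (ih _ (Or.inl rfl))
      · obtain rfl : c = T.out v := h2
        subst h1
        obtain rfl : u = v := T.ins_unique hu h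
        exact ih _ (Or.inl rfl)

/-- Chopping off the top vertex `w` with all its inputs. -/
def topFace (w : T.Vert) (h : ∀ a ∈ T.ins w, T.IsLeaf a) : Tree where
  Edge := {a : T.Edge // a ∉ T.ins w}
  Vert := {u : T.Vert // u ≠ w}
  finite_edge := inferInstance
  root := ⟨T.root, fun h' => (T.exists_ins_iff _).1 ⟨w, h'⟩ rfl⟩
  out u := ⟨T.out u.1, fun h' => h _ h' u.1 rfl⟩
  ins u := {a | a.1 ∈ T.ins u.1}
  out_inj h' := Subtype.ext (T.out_inj (congrArg Subtype.val h'))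
  ins_unique h1 h2 := Subtype.ext (T.ins_unique h1 h2)
  exists_ins_iff := by
    rintro ⟨a, ha⟩
    rw [Ne, Subtype.mk.injEq, ← Ne, ← T.exists_ins_iff]
    constructor
    · rintro ⟨u, h1⟩
      exact ⟨_, h1⟩
    · rintro ⟨u, hu⟩
      exact ⟨⟨u, fun h' => ha (h' ▸ hu)⟩, hu⟩
  connected := by
    rintro ⟨a, ha⟩
    have hb := T.connected a
    induction hb using Relation.ReflTransGen.head_induction_on with
    | refl => exact Relation.ReflTransGen.refl
    | head hs _ ih =>
      obtain ⟨u, hu, rfl⟩ := hs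
      exact Relation.ReflTransGen.head
        ⟨⟨u, fun h' => ha (h' ▸ hu)⟩, hu, rfl⟩ (ih (fun h' => h _ h' u rfl))

/-- Chopping off the bottom vertex `v` with the root and all its inputs except `e`. -/
def bottomFace (v : T.Vert) (e : T.Edge) (hv : T.out v = T.root) (he : e ∈ T.ins v)
    (h : ∀ a ∈ T.ins v, a ≠ e → T.IsLeaf a) : Tree where
  Edge := {a : T.Edge // a ≠ T.root ∧ (a ∈ T.ins v → a = e)}
  Vert := {u : T.Vert // u ≠ v}
  finite_edge := inferInstance
  root := ⟨e, (T.exists_ins_iff _).1 ⟨v, he⟩, fun _ => rfl⟩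
  out u := ⟨T.out u.1, fun h' => u.2 (T.out_inj (h'.trans hv.symm)),
    fun h' => by_contra fun hne => h _ h' hne u.1 rfl⟩
  ins u := {a | a.1 ∈ T.ins u.1}
  out_inj h' := Subtype.ext (T.out_inj (congrArg Subtype.val h'))
  ins_unique h1 h2 := Subtype.ext (T.ins_unique h1 h2)
  exists_ins_iff := by
    rintro ⟨a, ha, ha'⟩
    constructor
    · rintro ⟨u, h1⟩ h'
      obtain rfl : a = e := congrArg Subtype.val h'
      exact u.2 (T.ins_unique h1 he)
    · intro hae'
      have hae : a ≠ e := fun h' => hae' (Subtype.ext h')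
      obtain ⟨u, hu⟩ := (T.exists_ins_iff a).2 ha
      exact ⟨⟨u, fun h' => hae (ha' (h' ▸ hu))⟩, hu⟩
  connected := by
    rintro ⟨a, ha, ha'⟩
    have hb := T.connected a
    induction hb using Relation.ReflTransGen.head_induction_on with
    | refl => exact absurd rfl ha
    | @head x y hs _ ih =>
      obtain ⟨u, hu, rfl⟩ := hs
      by_cases huv : u = v
      · subst huv
        obtain rfl := ha' hu
        exact Relation.ReflTransGen.refl
      · exact Relation.ReflTransGen.head ⟨⟨u, huv⟩, hu, rfl⟩
          (ih (fun h' => huv (T.out_inj (h'.trans hv.symm)))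
            (fun h' => by_contra fun hne => h _ h' hne u rfl))

/-- The tree `∂_f T`. -/
def Face.tree : T.Face → Tree
  | .inner v w h => innerFace v w h
  | .top w h => topFace w h
  | .bottom v e hv he h => bottomFace v e hv he h

theorem card_vert_ne {n : ℕ} (hn : T.size = n + 1) (w : T.Vert) :
    Nat.card {u : T.Vert // u ≠ w} = n := by
  classical
  have := Fintype.ofFinite T.Vert
  rw [size, Nat.card_eq_fintype_card] at hn
  rw [Nat.card_eq_fintype_card, Fintype.card_subtype_compl, Fintype.card_subtype_eq, hn]
  rfl

/-- An elementary face has one vertex less. -/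
theorem Face.size_tree {n : ℕ} (hn : T.size = n + 1) (f : T.Face) : f.tree.size = n := by
  cases f <;> exact card_vert_ne hn _

/-- The inclusion `∂_e T ⟶ T` of an inner face. The vertex `v` of `∂_e T` is sent to the
composition `v ∘_e w`. -/
noncomputable def innerIncl (v w : T.Vert) (h : T.out w ∈ T.ins v) : innerFace v w h ⟶ T :=
  homMk (S := innerFace v w h) Subtype.val <| by
    rintro ⟨u, hu⟩
    by_cases huv : u = v
    · subst huv
      let J : T.ins u → Type := fun i =>
        {a : T.Edge // (i.1 = T.out w ∧ a ∈ T.ins w) ∨ (i.1 ≠ T.out w ∧ a = i.1)}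
      have hJ : ∀ i : T.ins u, T.Gen (J i) (fun a => a.1) i.1 := by
        rintro ⟨i, hi⟩
        by_cases hiw : i = T.out w
        · refine (Gen.vertex w).of_equiv
            (Equiv.subtypeEquivRight (fun a => ?_)) (fun _ => rfl) hiw
          simp [hiw]
        · refine (Gen.one i).of_equiv (⟨fun _ => (), fun _ => ⟨i, Or.inr ⟨hiw, rfl⟩⟩,
            ?_, fun _ => rfl⟩) ?_ rfl
          · rintro ⟨a, ha | ha⟩
            · exact absurd ha.1 hiw
            · exact Subtype.ext ha.2.symm
          · rintro ⟨a, ha | ha⟩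
            · exact absurd ha.1 hiw
            · exact ha.2
      have h1 : ∀ k : Σ i, J i, k.2.1 ≠ T.out w := by
        rintro ⟨⟨i, hi⟩, ⟨a, h1 | h1⟩⟩
        · exact fun h' => T.out_notMem_ins w (h' ▸ h1.2)
        · exact fun h' => h1.1 (h1.2.symm.trans h')
      have h2 : ∀ k : Σ i, J i, k.2.1 ∈ T.ins u ∨ (u = u ∧ k.2.1 ∈ T.ins w) := by
        rintro ⟨⟨i, hi⟩, ⟨a, h1 | h1⟩⟩
        · exact Or.inr ⟨rfl, h1.2⟩
        · exact Or.inl (h1.2.symm ▸ hi)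
      refine (Gen.comp (Gen.vertex u) hJ).of_bijective
        (fun k => ⟨⟨k.2.1, h1 k⟩, h2 k⟩) ⟨?_, ?_⟩ (fun _ => rfl)
      · rintro ⟨⟨i, hi⟩, ⟨a, ha⟩⟩ ⟨⟨i', hi'⟩, ⟨a', ha'⟩⟩ haa
        obtain rfl : a = a' := congrArg (fun x => x.1.1) haa
        obtain rfl : i = i' := by
          rcases ha with ha | ha <;> rcases ha' with ha' | ha'
          · exact ha.1.trans ha'.1.symm
          · have hm : a ∈ T.ins u := ha'.2.symm ▸ hi'
            exact absurd (T.ins_unique hm ha.2) hu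
          · have hm : a ∈ T.ins u := ha.2.symm ▸ hi
            exact absurd (T.ins_unique hm ha'.2) hu
          · exact ha.2.symm.trans ha'.2
        rfl
      · rintro ⟨⟨a, ha⟩, h1 | ⟨-, h1⟩⟩
        · exact ⟨⟨⟨a, h1⟩, ⟨a, Or.inr ⟨ha, rfl⟩⟩⟩, rfl⟩
        · exact ⟨⟨⟨_, h⟩, ⟨a, Or.inl ⟨rfl, h1⟩⟩⟩, rfl⟩
    · refine (Gen.vertex u).of_equiv ⟨fun a => ⟨a.1.1, a.2.resolve_right fun h' => huv h'.1⟩,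
        fun a => ⟨⟨a.1, fun h' => huv (T.ins_unique a.2 (h'.symm ▸ h))⟩, Or.inl a.2⟩,
        fun _ => rfl, fun _ => rfl⟩ (fun _ => rfl) rfl

/-- The inclusion of a top face. -/
def topIncl (w : T.Vert) (h : ∀ a ∈ T.ins w, T.IsLeaf a) : topFace w h ⟶ T :=
  homMk (S := topFace w h) Subtype.val <| by
    rintro ⟨u, hu⟩
    exact (Gen.vertex u).of_equiv ⟨fun a => ⟨a.1.1, a.2⟩,
      fun a => ⟨⟨a.1, fun h' => hu (T.ins_unique a.2 h')⟩, a.2⟩,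
      fun _ => rfl, fun _ => rfl⟩ (fun _ => rfl) rfl

/-- The inclusion of a bottom face. -/
def bottomIncl (v : T.Vert) (e : T.Edge) (hv : T.out v = T.root) (he : e ∈ T.ins v)
    (h : ∀ a ∈ T.ins v, a ≠ e → T.IsLeaf a) : bottomFace v e hv he h ⟶ T :=
  homMk (S := bottomFace v e hv he h) Subtype.val <| by
    rintro ⟨u, hu⟩
    exact (Gen.vertex u).of_equiv ⟨fun a => ⟨a.1.1, a.2⟩,
      fun a => ⟨⟨a.1, (T.exists_ins_iff _).1 ⟨u, a.2⟩,
        fun h' => absurd (T.ins_unique a.2 h') hu⟩, a.2⟩,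
      fun _ => rfl, fun _ => rfl⟩ (fun _ => rfl) rfl

/-- The elementary face map `∂_f : ∂_f T ⟶ T`. -/
noncomputable def Face.incl : (f : T.Face) → (f.tree ⟶ T)
  | .inner v w h => innerIncl v w h
  | .top w h => topIncl w h
  | .bottom v e hv he h => bottomIncl v e hv he h

/-- The sign `sgn_p(∂_f)` of an elementary face map with respect to a planar structure:
`(-1)^k` for an inner edge whose upper vertex has the label `k`, `(-1)^(k+1)` for a top vertex with
the label `k`, and `1` for a bottom face. In particular, for a corolla the inclusion of the root
has the sign `-1` (the only vertex is a top vertex with the label `0`) and the inclusion of a leaf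
has the sign `1`. -/
noncomputable def Face.sgn (p : Planar T) : T.Face → ℤ
  | .inner _ w _ => (-1) ^ p.label w
  | .top w _ => (-1) ^ (p.label w + 1)
  | .bottom _ _ _ _ _ => 1

/-! ### Elementary degeneracies -/

open Classical in
/-- The tree `σ_e T`, obtained by adding a copy `e'` of the edge `e` (the edge `none`) above `e`
and a unary vertex (the vertex `none`) with input `e'` and output `e`. If `e` is the output of a
vertex in `T`, then the output of this vertex in `σ_e T` is `e'`. -/
noncomputable def degen (T : Tree) (e : T.Edge) : Tree where
  Edge := Option T.Edge
  Vert := Option T.Vert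
  finite_edge := inferInstance
  root := some T.root
  out
    | none => some e
    | some v => if T.out v = e then none else some (T.out v)
  ins
    | none => {none}
    | some v => some '' T.ins v
  out_inj := by
    rintro (_ | v) (_ | w) h
    · rfl
    · simp only at h
      split_ifs at h with h1
      exact absurd (Option.some.inj h).symm h1
    · simp only at h
      split_ifs at h with h1
      exact absurd (Option.some.inj h) h1
    · simp only at h
      split_ifs at h with h1 h2 h2
      · exact congrArg some (T.out_inj (h1.trans h2.symm))
      · exact congrArg some (T.out_inj (Option.some.inj h))
  ins_unique := by
    rintro (_ | v) (_ | w) a h h'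
    · rfl
    · obtain ⟨b, -, rfl⟩ := h'
      simp at h
    · obtain ⟨b, -, rfl⟩ := h
      simp at h'
    · obtain ⟨b, hb, rfl⟩ := h
      obtain ⟨c, hc, hbc⟩ := h'
      obtain rfl := Option.some.inj hbc
      exact congrArg some (T.ins_unique hb hc)
  exists_ins_iff := by
    rintro (_ | a)
    · exact ⟨fun _ => by simp, fun _ => ⟨none, rfl⟩⟩
    · rw [Ne, Option.some.injEq, ← Ne, ← T.exists_ins_iff]
      constructor
      · rintro ⟨_ | v, h⟩
        · simp at h
        · obtain ⟨b, hb, hba⟩ := h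
          exact ⟨v, Option.some.inj hba ▸ hb⟩
      · rintro ⟨v, hv⟩
        exact ⟨some v, a, hv, rfl⟩
  connected := by
    intro a
    have key : ∀ b, Relation.ReflTransGen T.Step b T.root → Relation.ReflTransGen
        (fun (b c : Option T.Edge) => ∃ v : Option T.Vert,
          b ∈ (match v with
            | none => ({none} : Set (Option T.Edge))
            | some v => some '' T.ins v) ∧
          (match v with
            | none => some e
            | some v => if T.out v = e then none else some (T.out v)) = c)
        (some b) (some T.root) := by
      intro b hb
      induction hb using Relation.ReflTransGen.head_induction_on with
      | refl => exact Relation.ReflTransGen.refl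
      | @head x y hs _ ih =>
        obtain ⟨u, hu, rfl⟩ := hs
        by_cases hue : T.out u = e
        · refine Relation.ReflTransGen.head (b := none) ⟨some u, ⟨x, hu, rfl⟩, if_pos hue⟩ ?_
          exact Relation.ReflTransGen.head ⟨none, rfl, rfl⟩ (hue ▸ ih)
        · exact Relation.ReflTransGen.head ⟨some u, ⟨x, hu, rfl⟩, if_neg hue⟩ ih
    cases a with
    | none => exact Relation.ReflTransGen.head ⟨none, rfl, rfl⟩ (key e (T.connected e))
    | some a => exact key a (T.connected a)

open Classical in
/-- The elementary degeneracy map `σ_e : σ_e T ⟶ T`, which sends `e` and its copy to `e` and the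
new unary vertex to the identity operation. -/
noncomputable def degenMap (T : Tree) (e : T.Edge) : T.degen e ⟶ T :=
  homMk (S := T.degen e) (fun a => Option.getD a e) <| by
    rintro (_ | v)
    · refine (Gen.one e).of_equiv (J := Unit) ⟨fun _ => (), fun _ => ⟨none, rfl⟩, ?_,
        fun _ => rfl⟩ ?_ rfl
      · rintro ⟨a, ha⟩
        obtain rfl : a = none := ha
        rfl
      · rintro ⟨a, ha⟩
        obtain rfl : a = none := ha
        rfl
    · have ho : Option.getD ((T.degen e).out (some v)) e = T.out v := by
        change Option.getD (ite (T.out v = e) none (some (T.out v))) e = T.out v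
        split_ifs with h
        · exact h.symm
        · rfl
      rw [ho]
      refine (Gen.vertex v).of_bijective (fun a => ⟨some a.1, a.1, a.2, rfl⟩) ⟨?_, ?_⟩
        (fun _ => rfl)
      · intro a b hab
        exact Subtype.ext (Option.some.inj (congrArg Subtype.val hab))
      · rintro ⟨_, a, ha, rfl⟩
        exact ⟨⟨a, ha⟩, rfl⟩

end Tree

/-! ### The complex of a dendroidal set -/

/-- A dendroidal set is a presheaf of sets on the category of trees. -/
abbrev DendroidalSet : Type _ := Treeᵒᵖ ⥤ Type u

/-- The dendroidal set `P` of planar structures. -/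
def planarPresheaf : DendroidalSet where
  obj T := Planar T.unop
  map f := ↾ (Planar.pullback f.unop)
  map_id T := by
    refine ConcreteCategory.hom_ext _ _ (fun p => ?_)
    exact Planar.pullback_id p
  map_comp f g := by
    refine ConcreteCategory.hom_ext _ _ (fun p => ?_)
    exact Planar.pullback_comp g.unop f.unop p

variable (X : DendroidalSet.{u})

/-- The dendrex `f^* x`. -/
def DendroidalSet.restrict {X : DendroidalSet.{u}} {S T : Tree} (f : S ⟶ T)
    (x : X.obj (Opposite.op T)) : X.obj (Opposite.op S) := X.map f.op x

/-- A triple `(T, p, x)` of a tree with `n` vertices, a planar structure and a dendrex `x ∈ X_T`. -/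
structure PlanarDendrex (n : ℕ) where
  tree : Tree
  size_tree : tree.size = n
  planar : Planar tree
  dendrex : X.obj (Opposite.op tree)

/-- The free abelian group `C(X)_n` generated by the triples `(T, p, x)` with `|T| = n`. -/
abbrev C (n : ℕ) := FreeAbelianGroup (PlanarDendrex X n)

/-- The subgroup `A(X)_n` of `C(X)_n` generated by the elements
`(T, p, x) - sgn(p', τ^* p) (T', p', τ^* x)` for isomorphisms `τ : T' ⟶ T`. -/
def A (n : ℕ) : AddSubgroup (C X n) :=
  AddSubgroup.closure {y | ∃ (T T' : Tree) (hT : T.size = n) (hT' : T'.size = n)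
    (p : Planar T) (p' : Planar T') (τ : T' ≅ T) (x : X.obj (Opposite.op T)),
    y = FreeAbelianGroup.of ⟨T, hT, p, x⟩ -
      ((Planar.sgn p' (Planar.pullback τ.hom p) : ℤˣ) : ℤ) •
        FreeAbelianGroup.of ⟨T', hT', p', DendroidalSet.restrict τ.hom x⟩}

/-- The abelian group `Ch^un(X)_n`. -/
abbrev Chun (n : ℕ) := C X n ⧸ A X n

variable {X}

/-- The class `[T, p, x]`. -/
def PlanarDendrex.cls {n : ℕ} (g : PlanarDendrex X n) : Chun X n :=
  QuotientAddGroup.mk (FreeAbelianGroup.of g)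

/-- The triple `(∂_f T, p_f, ∂_f^* x)`. -/
noncomputable def PlanarDendrex.face {n : ℕ} (g : PlanarDendrex X (n + 1)) (f : g.tree.Face) :
    PlanarDendrex X n where
  tree := f.tree
  size_tree := f.size_tree g.size_tree
  planar := Planar.pullback f.incl g.planar
  dendrex := DendroidalSet.restrict f.incl g.dendrex

/-- A dendrex is degenerate if it is in the image of `σ^*` for an elementary degeneracy map `σ`
(composed with an isomorphism onto its source). -/
def IsDegenerate {T : Tree} (x : X.obj (Opposite.op T)) : Prop :=
  ∃ (S : Tree) (e : S.Edge) (α : T ≅ S.degen e) (y : X.obj (Opposite.op S)),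
    x = DendroidalSet.restrict (α.hom ≫ S.degenMap e) y

variable (X)

/-- The subgroup `D(X)_n` of `Ch^un(X)_n` generated by the classes of degenerate dendrices. -/
def D (n : ℕ) : AddSubgroup (Chun X n) :=
  AddSubgroup.closure {y | ∃ g : PlanarDendrex X n, IsDegenerate g.dendrex ∧ y = g.cls}

/-- A family of homomorphisms `d : Ch^un(X)_{n+1} → Ch^un(X)_n` is given on the generators by the
signed sum of the elementary faces. -/
def IsFaceDifferential (d : ∀ n : ℕ, Chun X (n + 1) →+ Chun X n) : Prop :=
  ∀ (n : ℕ) (g : PlanarDendrex X (n + 1)),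
    d n g.cls = ∑ f : g.tree.Face, f.sgn g.planar • (g.face f).cls

end Dendroidal

namespace Dendroidal
open CategoryTheory
namespace Tree

/-! ### The order on the edges -/

/-! A tree is determined by the order on its edges together with the set of edges that are outputs
of vertices, because the inputs of a vertex are exactly the edges covering its output
(`mem_ins_iff_covers`). Hence two trees embedded in `T` with the same edges and the same vertex
outputs are isomorphic over `T` (`exists_iso_of_embeddings`), and the dendrices and planar
structures restricted to them have the same class (`cls_eq_of_embeddings`). Comparing faces thereby
becomes comparing sets of removed edges and vertices.

An elementary face leaves out one vertex `w` and has a kind (inner, top, bottom). Its sign is a sign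
of the kind times `(-1)^label w` (`Face.sgn_eq`). Counting inversions shows that leaving out `w`
changes `sgn(p', p)` by the labels of `w` in `p'` and `p` (`Planar.sgn_pullback`), which is exactly
the difference between the face signs for `p'` and `p`. So the signed sum of faces respects the
relations and `d` exists; it is unique because the classes generate.

For `d ∘ d = 0`, an iterated face is encoded by two vertices `w`, `x` and two kinds, with sign the
product of the kind signs and of `(-1)^(label w + label x + [w before x])`. The involution
`FacePair.partner` keeps the composite subtree. It interchanges the two faces, except for certain
adjacent vertices, where contracting the edge between them and chopping off the merged vertex is
matched with chopping off both vertices one after the other. Either the two vertices trade places,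
which flips `[w before x]`, or an inner face is traded for a top face, which flips the kind sign; so
the terms cancel in pairs.

For degenerate dendrices, two faces of `σ_e S`, leaving out `e` or its copy, become bijections onto
the edges of `S` after composition with `σ_e`. They have the same class and opposite signs. Every
other face is again of the form `σ_{e₀} S'` for a face `S'` of `S`, hence carries a degenerate
dendrex. -/

theorem mem_ins_iff_covers {T : Tree} {v : T.Vert} {a : T.Edge} :
    a ∈ T.ins v ↔ T.Below (T.out v) a ∧ a ≠ T.out v ∧
      ∀ c, T.Below (T.out v) c → T.Below c a → c = T.out v ∨ c = a := by
  constructor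
  · intro h
    refine ⟨out_below h, fun h' => out_notMem_ins v (h' ▸ h), fun c h1 h2 => ?_⟩
    by_cases hc : c = a
    · exact Or.inr hc
    · exact Or.inl (below_antisymm (below_out_of_ne h2 h hc) h1)
  · rintro ⟨h1, h2, h3⟩
    rcases Relation.ReflTransGen.cases_head h1 with h4 | ⟨c, ⟨u, hu, rfl⟩, h4⟩
    · exact absurd h4 h2
    · rcases h3 _ h4 (out_below hu) with h5 | h5
      · rwa [← T.out_inj h5]
      · exact absurd (h5 ▸ hu) (out_notMem_ins u)

instance (T : Tree) : Nonempty (Planar T) :=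
  ⟨{ lt := fun _ => WellOrderingRel
     irrefl := fun v i => irrefl_of (WellOrderingRel (α := T.ins v)) i
     trans := fun v _ _ _ h h' => trans_of (WellOrderingRel (α := T.ins v)) h h'
     total := fun v i j h =>
      (trichotomous_of (WellOrderingRel (α := T.ins v)) i j).imp_right (fun h' => h'.resolve_left h) }⟩

/-- A morphism which is injective on edges reflects the order on the edges. -/
theorem below_edgeMap_iff {S T : Tree} {f : S ⟶ T} (hf : Function.Injective (edgeMap f))
    {a b : S.Edge} : T.Below (edgeMap f a) (edgeMap f b) ↔ S.Below a b := by
  refine ⟨fun h => ?_, edgeMap_below f⟩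
  by_contra hab
  -- An auxiliary planar structure: if `a` and `b` are incomparable, one is to the left of the other
  -- for the induced structure, hence the same holds for their images, which are then incomparable
  -- too.
  obtain ⟨p⟩ : Nonempty (Planar T) := inferInstance
  by_cases hba : S.Below b a
  · exact hab (hf (below_antisymm h (edgeMap_below f hba)) ▸ below_refl a)
  · rcases (Planar.pullback f p).left_total hab hba with h1 | h1
    · exact (Planar.left_pullback f p h1).not_below.1 h
    · exact (Planar.left_pullback f p h1).not_below.2 h

/-! ### Isomorphisms of trees -/

/-- Inputs are the covers of the output, so `σ` carries the inputs of `v` onto those of `v'`, and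
the single vertex `v'` generates the required operation. -/
theorem gen_of_order_iso {S S' : Tree} (σ : S.Edge ≃ S'.Edge)
    (hb : ∀ a b, S'.Below (σ a) (σ b) ↔ S.Below a b)
    (ho : ∀ v, ∃ v', S'.out v' = σ (S.out v)) (v : S.Vert) :
    S'.Gen (S.ins v) (fun a => σ a.1) (σ (S.out v)) := by
  obtain ⟨v', hv'⟩ := ho v
  have h : ∀ a, a ∈ S.ins v ↔ σ a ∈ S'.ins v' := by
    intro a
    rw [mem_ins_iff_covers, mem_ins_iff_covers, hv', hb, σ.injective.ne_iff]
    refine and_congr_right fun _ => and_congr_right fun _ => ?_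
    rw [← σ.forall_congr_right]
    simp only [hb, σ.injective.eq_iff]
  exact (Gen.vertex v').of_equiv (σ.subtypeEquiv h) (fun _ => rfl) hv'.symm

/-- An isomorphism of the orders on the edges which respects outputs of vertices is an
isomorphism of trees. -/
def isoOfOrderIso {S S' : Tree} (σ : S.Edge ≃ S'.Edge)
    (hb : ∀ a b, S'.Below (σ a) (σ b) ↔ S.Below a b)
    (ho : ∀ v, ∃ v', S'.out v' = σ (S.out v)) (ho' : ∀ v', ∃ v, σ (S.out v) = S'.out v') :
    S ≅ S' where
  hom := homMk σ (gen_of_order_iso σ hb ho)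
  inv := homMk σ.symm (gen_of_order_iso σ.symm
    (fun a b => by rw [← hb, σ.apply_symm_apply, σ.apply_symm_apply])
    (fun v' => (ho' v').imp fun v hv => by rw [← hv, σ.symm_apply_apply]))
  hom_inv_id := hom_ext fun a => σ.symm_apply_apply a
  inv_hom_id := hom_ext fun a => σ.apply_symm_apply a

/-- Two embeddings of trees into `T` with the same edges and the same outputs of vertices differ by
an isomorphism. -/
theorem exists_iso_of_embeddings {S S' : Tree} {E : Type} {r : E → E → Prop}
    {φ : S.Edge → E} {ψ : S'.Edge → E}
    (hφ : Function.Injective φ) (hψ : Function.Injective ψ)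
    (hbφ : ∀ a b, r (φ a) (φ b) ↔ S.Below a b) (hbψ : ∀ a b, r (ψ a) (ψ b) ↔ S'.Below a b)
    (hr : Set.range φ = Set.range ψ)
    (ho : Set.range (fun v => φ (S.out v)) = Set.range (fun v => ψ (S'.out v))) :
    ∃ α : S ≅ S', ∀ a, ψ (edgeMap α.hom a) = φ a := by
  let σ : S.Edge ≃ S'.Edge := (Equiv.ofInjective φ hφ).trans
    ((Equiv.setCongr hr).trans (Equiv.ofInjective ψ hψ).symm)
  have hσ : ∀ a, ψ (σ a) = φ a := fun a => Equiv.apply_ofInjective_symm hψ _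
  refine ⟨isoOfOrderIso σ (fun a b => ?_) (fun v => ?_) (fun v' => ?_), hσ⟩
  · rw [← hbφ, ← hbψ, hσ, hσ]
  · obtain ⟨v', hv'⟩ : φ (S.out v) ∈ Set.range (fun v => ψ (S'.out v)) := ho ▸ ⟨v, rfl⟩
    exact ⟨v', hψ (by rw [hσ]; exact hv')⟩
  · obtain ⟨v, hv⟩ : ψ (S'.out v') ∈ Set.range (fun v => φ (S.out v)) := ho ▸ ⟨v', rfl⟩
    exact ⟨v, hψ (by rw [hσ]; exact hv)⟩

/-- An operation either has a lowest vertex, or is an identity up to reindexing, and then its input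
is its output. For an injective map the second case cannot occur for the image of a vertex, which
yields `vertMap`. -/
theorem Gen.exists_input_or_out {T : Tree} {I : Type} [Finite I] {c : I → T.Edge} {e : T.Edge}
    (h : T.Gen I c e) : (∃ i, c i = e) ∨ ∃ v, T.out v = e := by
  induction h with
  | one e => exact Or.inl ⟨(), rfl⟩
  | vertex v => exact Or.inr ⟨v, rfl⟩
  | comp _ _ ihx ihy =>
    rcases ihx with ⟨i, hi⟩ | h
    · rcases ihy i with ⟨j, hj⟩ | ⟨v, hv⟩
      · exact Or.inl ⟨⟨i, j⟩, hj.trans hi⟩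
      · exact Or.inr ⟨v, hv.trans hi⟩
    · exact Or.inr h
  | reindex σ _ ih =>
    rcases ih with ⟨i, hi⟩ | h
    · exact Or.inl ⟨σ.symm i, by simpa using hi⟩
    · exact Or.inr h

/-- A morphism which is injective on edges sends outputs of vertices to outputs of vertices. -/
theorem exists_out_eq_edgeMap {S T : Tree} {f : S ⟶ T} (hf : Function.Injective (edgeMap f))
    (v : S.Vert) : ∃ w, T.out w = edgeMap f (S.out v) := by
  rcases (gen_map f (Gen.vertex v)).exists_input_or_out with ⟨i, hi⟩ | h
  · exact absurd (hf hi ▸ i.2) (out_notMem_ins v)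
  · exact h

/-- The map on vertices underlying a morphism which is injective on edges, sending a vertex to the
lowest vertex of its image. -/
noncomputable def vertMap {S T : Tree} (f : S ⟶ T) (hf : Function.Injective (edgeMap f))
    (v : S.Vert) : T.Vert := (exists_out_eq_edgeMap hf v).choose

theorem out_vertMap {S T : Tree} (f : S ⟶ T) (hf : Function.Injective (edgeMap f))
    (v : S.Vert) : T.out (vertMap f hf v) = edgeMap f (S.out v) :=
  (exists_out_eq_edgeMap hf v).choose_spec

theorem vertMap_injective {S T : Tree} (f : S ⟶ T) (hf : Function.Injective (edgeMap f)) :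
    Function.Injective (vertMap f hf) := fun u v h => by
  have := congrArg T.out h
  rw [out_vertMap, out_vertMap] at this
  exact S.out_inj (hf this)

/-! ### Edges, vertices and leaves under isomorphisms -/

theorem edgeMap_inv_hom {S T : Tree} (τ : S ≅ T) (a : T.Edge) :
    edgeMap τ.hom (edgeMap τ.inv a) = a := by
  rw [← edgeMap_comp, τ.inv_hom_id, edgeMap_id]

theorem edgeMap_hom_inv {S T : Tree} (τ : S ≅ T) (a : S.Edge) :
    edgeMap τ.inv (edgeMap τ.hom a) = a := edgeMap_inv_hom τ.symm a

theorem edgeMap_iso_injective {S T : Tree} (τ : S ≅ T) : Function.Injective (edgeMap τ.hom) :=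
  Function.LeftInverse.injective (edgeMap_hom_inv τ)

theorem edgeMap_iso_surjective {S T : Tree} (τ : S ≅ T) : Function.Surjective (edgeMap τ.hom) :=
  fun a => ⟨_, edgeMap_inv_hom τ a⟩

theorem vertMap_iso_surjective {S T : Tree} (τ : S ≅ T) :
    Function.Surjective (vertMap τ.hom (edgeMap_iso_injective τ)) := by
  intro w
  refine ⟨vertMap τ.inv (edgeMap_iso_injective τ.symm) w, T.out_inj ?_⟩
  rw [out_vertMap, out_vertMap, edgeMap_inv_hom]

theorem edgeMap_mem_ins_iff {S T : Tree} (τ : S ≅ T) (v : S.Vert) (a : S.Edge) :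
    edgeMap τ.hom a ∈ T.ins (vertMap τ.hom (edgeMap_iso_injective τ) v) ↔ a ∈ S.ins v := by
  have hi := edgeMap_iso_injective τ
  rw [mem_ins_iff_covers, mem_ins_iff_covers, out_vertMap, below_edgeMap_iff hi, hi.ne_iff]
  refine and_congr_right fun _ => and_congr_right fun _ => ?_
  rw [← (edgeMap_iso_surjective τ).forall.symm]
  simp only [below_edgeMap_iff hi, hi.eq_iff]

theorem edgeMap_isLeaf_iff {S T : Tree} (τ : S ≅ T) (a : S.Edge) :
    T.IsLeaf (edgeMap τ.hom a) ↔ S.IsLeaf a := by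
  have hi := edgeMap_iso_injective τ
  rw [IsLeaf, IsLeaf, (vertMap_iso_surjective τ).forall]
  simp only [out_vertMap, ne_eq, hi.eq_iff]

theorem edgeMap_iso_root {S T : Tree} (τ : S ≅ T) : edgeMap τ.hom S.root = T.root := by
  refine below_antisymm ?_ (root_below _)
  rw [← edgeMap_inv_hom τ T.root]
  exact edgeMap_below _ (root_below _)

end Tree
namespace Planar

open Dendroidal.Tree

/-! ### Planar structures, labels and signs under embeddings -/

variable {S T : Tree} {f : S ⟶ T} (hf : Function.Injective (edgeMap f)) (p p' : Planar T)

/-- Morphisms preserve the order, so edges with incomparable images are incomparable; totality of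
the left-right order and its asymmetry in `T` then leave only one possibility. -/
theorem left_pullback_iff {a b : S.Edge} :
    (pullback f p).Left a b ↔ p.Left (edgeMap f a) (edgeMap f b) := by
  refine ⟨left_pullback f p, fun h => ?_⟩
  rcases (pullback f p).left_total (fun h' => h.not_below.1 (edgeMap_below f h'))
    (fun h' => h.not_below.2 (edgeMap_below f h')) with h1 | h1
  · exact h1
  · exact absurd (left_pullback f p h1) h.asymm

theorem before_pullback_iff {u w : S.Vert} :
    (pullback f p).Before u w ↔ p.Before (vertMap f hf u) (vertMap f hf w) := by
  rw [Before, Before, out_vertMap, out_vertMap, left_pullback_iff, below_edgeMap_iff hf,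
    (vertMap_injective f hf).ne_iff]

theorem not_before_iff {u w : T.Vert} (h : u ≠ w) : ¬ p.Before u w ↔ p.Before w u :=
  ⟨(p.before_total h).resolve_left, fun h1 h2 => Before.irrefl (h1.trans h2)⟩

open Classical in
-- Written as a sum of indicators, a label can be compared with that in a face by splitting off one
-- summand.
theorem label_eq_sum [Fintype T.Vert] (w : T.Vert) :
    p.label w = ∑ u, if p.Before u w then 1 else 0 := by
  rw [label, Nat.card_eq_fintype_card, Fintype.card_subtype, Finset.card_filter]

theorem label_lt_label_iff {u w : T.Vert} : p.label u < p.label w ↔ p.Before u w := by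
  refine ⟨fun h => ?_, label_lt_label⟩
  rcases eq_or_ne u w with rfl | hne
  · exact absurd h (lt_irrefl _)
  · by_contra h1
    exact absurd (label_lt_label ((p.not_before_iff hne).1 h1)) h.asymm

open Classical in
-- The sign of a permutation counts its inversions. Indexing the pairs by vertices instead of labels
-- allows restriction to the vertices of a face, where the labels are shifted.
theorem sgn_eq_prod [Fintype T.Vert] : sgn p' p = ∏ w, ∏ u,
    if p'.Before u w then (if p.Before u w then 1 else -1) else 1 := by
  rw [sgn, Equiv.Perm.sign_eq_prod_prod_Iio, ← p'.labelEquiv.prod_comp]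
  refine Finset.prod_congr rfl fun w _ => ?_
  rw [← Finset.prod_filter]
  refine (Finset.prod_bij (fun u _ => p'.labelEquiv u) ?_ ?_ ?_ ?_).symm
  · intro u hu
    rw [Finset.mem_filter] at hu
    exact Finset.mem_Iio.2 (label_lt_label hu.2)
  · exact fun u _ v _ h => p'.labelEquiv.injective h
  · intro i hi
    refine ⟨p'.labelEquiv.symm i, ?_, by simp⟩
    rw [Finset.mem_filter, ← label_lt_label_iff]
    refine ⟨Finset.mem_univ _, ?_⟩
    have h : p'.labelEquiv (p'.labelEquiv.symm i) < p'.labelEquiv w := by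
      simpa using Finset.mem_Iio.1 hi
    exact h
  · intro u _
    have h : (p.labelEquiv u < p.labelEquiv w) ↔ p.Before u w := p.label_lt_label_iff
    simp only [Equiv.trans_apply, Equiv.symm_apply_apply, h]

theorem sgn_self : sgn p p = 1 := by
  rw [sgn, Equiv.symm_trans_self]
  exact Equiv.Perm.sign_refl

/-- Every edge lies above the output of the root vertex, so no vertex precedes it. This lets the
sign `1` of a bottom face be read as `(-1)^label`. -/
theorem label_eq_zero {v : T.Vert} (hv : T.out v = T.root) : p.label v = 0 := by
  classical
  have := Fintype.ofFinite T.Vert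
  rw [label_eq_sum]
  refine Finset.sum_eq_zero fun u _ => if_neg ?_
  rintro (⟨h, h'⟩ | h)
  · exact h (T.out_inj ((below_antisymm h' (hv ▸ root_below _))))
  · exact h.not_below.2 (hv ▸ root_below _)

/-! ### Leaving out one vertex -/

variable {r : T.Vert} (hr : Set.range (vertMap f hf) = {r}ᶜ)

include hr in
theorem vertMap_ne (u : S.Vert) : vertMap f hf u ≠ r := by
  have h : vertMap f hf u ∈ ({r}ᶜ : Set T.Vert) := hr ▸ ⟨u, rfl⟩
  exact h

include hr in
-- `Option S.Vert` is in bijection with `T.Vert`, with `none` corresponding to the omitted vertex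
-- `r`.
theorem prod_vert_eq {M : Type*} [CommMonoid M] [Fintype S.Vert] [Fintype T.Vert]
    (F : T.Vert → M) : ∏ w, F w = F r * ∏ u, F (vertMap f hf u) := by
  have hb : Function.Bijective (fun o : Option S.Vert => o.elim r (vertMap f hf)) := by
    constructor
    · rintro (_ | u) (_ | v) huv
      · rfl
      · exact absurd huv.symm (vertMap_ne hf hr v)
      · exact absurd huv (vertMap_ne hf hr u)
      · exact congrArg some (vertMap_injective f hf huv)
    · intro w
      by_cases hw : w = r
      · exact ⟨none, hw.symm⟩
      · obtain ⟨u, hu⟩ : w ∈ Set.range (vertMap f hf) := hr ▸ hw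
        exact ⟨some u, hu⟩
  rw [← hb.prod_comp, Fintype.prod_option]
  rfl

include hr in
theorem sum_vert_eq [Fintype S.Vert] [Fintype T.Vert] (F : T.Vert → ℕ) :
    ∑ w, F w = F r + ∑ u, F (vertMap f hf u) :=
  prod_vert_eq (M := Multiplicative ℕ) hf hr F

include hr in
open Classical in
/-- Leaving out the vertex `r` decreases the labels of the vertices after `r` by one. -/
theorem label_pullback_add (u : S.Vert) :
    (pullback f p).label u + (if p.Before r (vertMap f hf u) then 1 else 0) =
      p.label (vertMap f hf u) := by
  have := Fintype.ofFinite T.Vert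
  have := Fintype.ofFinite S.Vert
  rw [label_eq_sum, label_eq_sum, sum_vert_eq hf hr, add_comm]
  simp only [before_pullback_iff hf]

include hr in
/-- The change of the sign of a pair of planar structures when the vertex `r` is left out. -/
theorem sgn_pullback : sgn p' p =
    (-1) ^ (p'.label r + p.label r) * sgn (pullback f p') (pullback f p) := by
  classical
  have := Fintype.ofFinite T.Vert
  have := Fintype.ofFinite S.Vert
  simp only [sgn_eq_prod, before_pullback_iff hf]
  simp only [prod_vert_eq hf hr]
  simp only [Before.irrefl, if_false, one_mul]
  rw [Finset.prod_mul_distrib, ← mul_assoc, ← Finset.prod_mul_distrib, pow_add]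
  congr 1
  -- What remains is the contribution of the pairs `{u, r}`: it is `-1` exactly when `p` and `p'`
  -- order the pair differently. Expanding both powers of `-1` over the same `u` allows a comparison
  -- factor by factor.
  have hl : ∀ q : Planar T, (-1 : ℤˣ) ^ q.label r =
      ∏ u : S.Vert, if q.Before (vertMap f hf u) r then -1 else 1 := by
    intro q
    rw [label_eq_sum, sum_vert_eq hf hr]
    simp only [Before.irrefl, if_false, zero_add]
    rw [← Finset.prod_pow_eq_pow_sum]
    refine Finset.prod_congr rfl fun u _ => ?_
    split_ifs <;> simp
  rw [hl, hl, ← Finset.prod_mul_distrib]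
  refine Finset.prod_congr rfl fun u _ => ?_
  have h1 := not_before_iff p (vertMap_ne hf hr u)
  have h2 := not_before_iff p' (vertMap_ne hf hr u)
  by_cases h : p.Before (vertMap f hf u) r <;> by_cases h' : p'.Before (vertMap f hf u) r <;>
    simp [h, h', ← h1, ← h2]

theorem label_pullback_iso (τ : S ≅ T) (u : S.Vert) :
    (pullback τ.hom p).label u = p.label (vertMap τ.hom (edgeMap_iso_injective τ) u) := by
  classical
  have := Fintype.ofFinite T.Vert
  have := Fintype.ofFinite S.Vert
  have hb : Function.Bijective (vertMap τ.hom (edgeMap_iso_injective τ)) :=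
    ⟨vertMap_injective _ _, vertMap_iso_surjective τ⟩
  rw [label_eq_sum, label_eq_sum, ← hb.sum_comp]
  simp only [before_pullback_iff (edgeMap_iso_injective τ)]

end Planar
namespace Tree

/-! ### Elementary faces by their vertex and their kind -/

theorem range_out_eq {S T : Tree} (f : S ⟶ T) (hf : Function.Injective (edgeMap f)) :
    Set.range (fun v => edgeMap f (S.out v)) = T.out '' Set.range (vertMap f hf) := by
  rw [← Set.range_comp]
  exact congrArg Set.range (funext fun v => (out_vertMap f hf v).symm)

theorem vertMap_comp {R S T : Tree} (f : R ⟶ S) (g : S ⟶ T) (hf : Function.Injective (edgeMap f))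
    (hg : Function.Injective (edgeMap g)) (hfg : Function.Injective (edgeMap (f ≫ g)))
    (v : R.Vert) : vertMap (f ≫ g) hfg v = vertMap g hg (vertMap f hf v) := T.out_inj <| by
  rw [out_vertMap, out_vertMap, out_vertMap, edgeMap_comp]

/-- The kinds of elementary faces obtained by leaving out a vertex `w`: the inner face contracting
the output of `w`, the top face chopping off `w`, or the bottom face chopping off `w` with all
inputs but `e`. -/
inductive FaceKind (E : Type)
  | inner
  | top
  | bottom (e : E)

/-- Functoriality of the kinds of faces in the set of edges. -/
def FaceKind.map {E F : Type} (φ : E → F) : FaceKind E → FaceKind F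
  | inner => inner
  | top => top
  | bottom e => bottom (φ e)

theorem FaceKind.map_injective {E F : Type} {φ : E → F} (hφ : Function.Injective φ) :
    Function.Injective (FaceKind.map φ) := by
  intro k l h
  cases k <;> cases l <;> simp_all [FaceKind.map, hφ.eq_iff]

/-- The sign of an elementary face apart from the sign of the label of its vertex. -/
def FaceKind.sgn {E : Type} : FaceKind E → ℤ
  | inner => 1
  | top => -1
  | bottom _ => 1

theorem FaceKind.sgn_map {E F : Type} (φ : E → F) (k : FaceKind E) : (k.map φ).sgn = k.sgn := by
  cases k <;> rfl

variable {T : Tree}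

/-- The condition for the existence of an elementary face of kind `k` leaving out `w`. -/
def IsFace (T : Tree) (w : T.Vert) : FaceKind T.Edge → Prop
  | .inner => T.out w ≠ T.root
  | .top => ∀ a ∈ T.ins w, T.IsLeaf a
  | .bottom e => T.out w = T.root ∧ e ∈ T.ins w ∧ ∀ a ∈ T.ins w, a ≠ e → T.IsLeaf a

/-- The edges left out by an elementary face. -/
def removedEdges (T : Tree) (w : T.Vert) : FaceKind T.Edge → Set T.Edge
  | .inner => {T.out w}
  | .top => T.ins w
  | .bottom e => insert (T.out w) (T.ins w \ {e})

namespace Face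

/-- The vertex left out by an elementary face; for an inner face this is the upper vertex. -/
def vertex : T.Face → T.Vert
  | .inner _ w _ => w
  | .top w _ => w
  | .bottom v _ _ _ _ => v

/-- The kind of an elementary face. -/
def kind : T.Face → FaceKind T.Edge
  | .inner _ _ _ => .inner
  | .top _ _ => .top
  | .bottom _ e _ _ _ => .bottom e

/-- The lower vertex of an inner face is redundant data, as an edge is an input of at most one
vertex. -/
theorem ext_vertex_kind {f g : T.Face} (h : f.vertex = g.vertex) (h' : f.kind = g.kind) :
    f = g := by
  cases f <;> cases g <;> simp only [kind, reduceCtorEq, FaceKind.bottom.injEq] at h' <;>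
    simp only [vertex] at h <;> subst h
  · rename_i v w hv v' hv'
    obtain rfl := T.ins_unique hv hv'
    rfl
  · rfl
  · subst h'
    rfl

theorem isFace (f : T.Face) : T.IsFace f.vertex f.kind := by
  cases f with
  | inner v w h => exact (T.exists_ins_iff _).1 ⟨v, h⟩
  | top w h => exact h
  | bottom v e hv he h => exact ⟨hv, he, h⟩

theorem exists_of_isFace {w : T.Vert} {k : FaceKind T.Edge} (h : T.IsFace w k) :
    ∃ f : T.Face, f.vertex = w ∧ f.kind = k := by
  cases k with
  | inner =>
    obtain ⟨v, hv⟩ := (T.exists_ins_iff _).2 h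
    exact ⟨.inner v w hv, rfl, rfl⟩
  | top => exact ⟨.top w h, rfl, rfl⟩
  | bottom e => exact ⟨.bottom w e h.1 h.2.1 h.2.2, rfl, rfl⟩

/-- The three sign conventions become one formula, because the vertex removed by a bottom face has
the label `0`. All later sign computations use only this form. -/
theorem sgn_eq (p : Planar T) (f : T.Face) :
    f.sgn p = f.kind.sgn * (-1) ^ p.label f.vertex := by
  cases f with
  | inner v w h => exact (one_mul _).symm
  | top w h => exact (pow_succ' _ _)
  | bottom v e hv he h =>
    simp [sgn, kind, FaceKind.sgn, vertex, p.label_eq_zero hv]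

theorem incl_injective (f : T.Face) : Function.Injective (edgeMap f.incl) := by
  cases f <;> exact Subtype.val_injective

theorem range_incl (f : T.Face) :
    Set.range (edgeMap f.incl) = (T.removedEdges f.vertex f.kind)ᶜ := by
  ext a
  cases f with
  | inner v w h => exact ⟨fun ⟨b, hb⟩ => hb ▸ b.2, fun h => ⟨⟨a, h⟩, rfl⟩⟩
  | top w h => exact ⟨fun ⟨b, hb⟩ => hb ▸ b.2, fun h => ⟨⟨a, h⟩, rfl⟩⟩
  | bottom v e hv he h =>
    have h1 : (a ≠ T.root ∧ (a ∈ T.ins v → a = e)) ↔ a ∉ T.removedEdges v (.bottom e) := by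
      simp only [removedEdges, Set.mem_insert_iff, Set.mem_sdiff, Set.mem_singleton_iff, hv]
      tauto
    exact ⟨fun ⟨b, hb⟩ => h1.1 (hb ▸ b.2), fun h => ⟨⟨a, h1.2 h⟩, rfl⟩⟩

/-- The vertices of an elementary face as vertices of the tree. -/
noncomputable def vert (f : T.Face) (u : f.tree.Vert) : T.Vert := vertMap f.incl f.incl_injective u

theorem out_vert (f : T.Face) (u : f.tree.Vert) :
    T.out (f.vert u) = edgeMap f.incl (f.tree.out u) :=
  out_vertMap f.incl f.incl_injective u

theorem vert_injective (f : T.Face) : Function.Injective f.vert :=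
  vertMap_injective f.incl f.incl_injective

theorem range_vert (f : T.Face) : Set.range f.vert = {f.vertex}ᶜ := by
  ext x
  cases f
  all_goals
    constructor
    · rintro ⟨u, rfl⟩ h
      exact u.2 ((T.out_inj (out_vert _ u)).symm.trans h)
    · exact fun h => ⟨⟨x, h⟩, T.out_inj (out_vert _ _)⟩

theorem vert_ne (f : T.Face) (u : f.tree.Vert) : f.vert u ≠ f.vertex := by
  have h : f.vert u ∈ ({f.vertex}ᶜ : Set T.Vert) := f.range_vert ▸ ⟨u, rfl⟩
  exact h

theorem exists_vert_eq (f : T.Face) {x : T.Vert} (h : x ≠ f.vertex) : ∃ u, f.vert u = x := by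
  have h : x ∈ ({f.vertex}ᶜ : Set T.Vert) := h
  rwa [← f.range_vert] at h

theorem range_out_incl (f : T.Face) :
    Set.range (fun v => edgeMap f.incl (f.tree.out v)) = T.out '' {f.vertex}ᶜ := by
  rw [range_out_eq _ f.incl_injective]
  exact congrArg _ f.range_vert

end Face

/-! ### Isomorphic trees have the same faces -/

theorem isFace_iso {S : Tree} (τ : S ≅ T) {w : S.Vert} {k : FaceKind S.Edge} (h : S.IsFace w k) :
    T.IsFace (vertMap τ.hom (edgeMap_iso_injective τ) w) (k.map (edgeMap τ.hom)) := by
  have hi := edgeMap_iso_injective τ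
  -- Transports the leaf condition for the inputs satisfying `P`: all inputs for a top face, the
  -- inputs different from `e` for a bottom face.
  have hl : ∀ P : S.Edge → Prop, (∀ a ∈ S.ins w, P a → S.IsLeaf a) →
      ∀ a ∈ T.ins (vertMap τ.hom hi w), (∀ b, edgeMap τ.hom b = a → P b) → T.IsLeaf a := by
    intro P hP a ha hPa
    obtain ⟨b, rfl⟩ := edgeMap_iso_surjective τ a
    exact (edgeMap_isLeaf_iff τ b).2 (hP b ((edgeMap_mem_ins_iff τ w b).1 ha) (hPa b rfl))
  cases k with
  | inner =>
    change T.out _ ≠ T.root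
    rw [out_vertMap, ← edgeMap_iso_root τ, hi.ne_iff]
    exact h
  | top => exact fun a ha => hl (fun _ => True) (fun a ha _ => h a ha) a ha (fun _ _ => trivial)
  | bottom e =>
    refine ⟨?_, (edgeMap_mem_ins_iff τ w e).2 h.2.1, fun a ha hae => ?_⟩
    · rw [out_vertMap, h.1, edgeMap_iso_root]
    · exact hl _ h.2.2 a ha (fun b hb hbe => hae (by rw [← hb, hbe]))

theorem Face.exists_mapIso {S : Tree} (τ : S ≅ T) (f : S.Face) : ∃ g : T.Face,
    g.vertex = vertMap τ.hom (edgeMap_iso_injective τ) f.vertex ∧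
      g.kind = f.kind.map (edgeMap τ.hom) :=
  Face.exists_of_isFace (isFace_iso τ f.isFace)

/-- The elementary face of `T` corresponding to an elementary face of an isomorphic tree. -/
noncomputable def Face.mapIso {S : Tree} (τ : S ≅ T) (f : S.Face) : T.Face :=
  (f.exists_mapIso τ).choose

theorem Face.vertex_mapIso {S : Tree} (τ : S ≅ T) (f : S.Face) :
    (f.mapIso τ).vertex = vertMap τ.hom (edgeMap_iso_injective τ) f.vertex :=
  (f.exists_mapIso τ).choose_spec.1

theorem Face.kind_mapIso {S : Tree} (τ : S ≅ T) (f : S.Face) :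
    (f.mapIso τ).kind = f.kind.map (edgeMap τ.hom) :=
  (f.exists_mapIso τ).choose_spec.2

theorem Face.mapIso_injective {S : Tree} (τ : S ≅ T) :
    Function.Injective (Face.mapIso τ) := by
  intro f g h
  refine Face.ext_vertex_kind ?_ ?_
  · apply vertMap_injective τ.hom (edgeMap_iso_injective τ)
    rw [← Face.vertex_mapIso, ← Face.vertex_mapIso, h]
  · apply FaceKind.map_injective (edgeMap_iso_injective τ)
    rw [← Face.kind_mapIso, ← Face.kind_mapIso, h]

theorem Face.mapIso_bijective {S : Tree} (τ : S ≅ T) : Function.Bijective (Face.mapIso τ) := by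
  refine (Nat.bijective_iff_injective_and_card _).2 ⟨mapIso_injective τ, ?_⟩
  -- The inverse isomorphism gives an injection in the other direction between these finite sets.
  exact le_antisymm (Nat.card_le_card_of_injective _ (mapIso_injective τ))
    (Nat.card_le_card_of_injective _ (mapIso_injective τ.symm))

theorem removedEdges_iso {S : Tree} (τ : S ≅ T) (w : S.Vert) (k : FaceKind S.Edge) :
    T.removedEdges (vertMap τ.hom (edgeMap_iso_injective τ) w) (k.map (edgeMap τ.hom)) =
      edgeMap τ.hom '' S.removedEdges w k := by
  have hi := edgeMap_iso_injective τ
  have hins : T.ins (vertMap τ.hom (edgeMap_iso_injective τ) w) = edgeMap τ.hom '' S.ins w := by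
    ext a
    obtain ⟨b, rfl⟩ := edgeMap_iso_surjective τ a
    rw [hi.mem_set_image, edgeMap_mem_ins_iff]
  cases k with
  | inner => exact (congrArg _ (out_vertMap _ _ _)).trans Set.image_singleton.symm
  | top => exact hins
  | bottom e =>
    simp only [removedEdges, FaceKind.map, Set.image_insert_eq, Set.image_sdiff hi,
      Set.image_singleton, hins, out_vertMap]

end Tree

/-! ### The classes of dendrices -/

open Dendroidal.Tree

variable {X : DendroidalSet.{u}}

theorem DendroidalSet.restrict_id {T : Tree} (x : X.obj (Opposite.op T)) :
    DendroidalSet.restrict (𝟙 T) x = x := by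
  simp [DendroidalSet.restrict]

theorem DendroidalSet.restrict_comp {R S T : Tree} (f : R ⟶ S) (g : S ⟶ T)
    (x : X.obj (Opposite.op T)) :
    DendroidalSet.restrict (f ≫ g) x = DendroidalSet.restrict f (DendroidalSet.restrict g x) := by
  simp [DendroidalSet.restrict]

theorem cls_eq_sgn_smul {n : ℕ} {T T' : Tree} (hT : T.size = n) (hT' : T'.size = n)
    (p : Planar T) (p' : Planar T') (τ : T' ≅ T) (x : X.obj (Opposite.op T)) :
    PlanarDendrex.cls ⟨T, hT, p, x⟩ = ((Planar.sgn p' (Planar.pullback τ.hom p) : ℤˣ) : ℤ) •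
      PlanarDendrex.cls ⟨T', hT', p', DendroidalSet.restrict τ.hom x⟩ := by
  have h : (QuotientAddGroup.mk (FreeAbelianGroup.of ⟨T, hT, p, x⟩ -
      ((Planar.sgn p' (Planar.pullback τ.hom p) : ℤˣ) : ℤ) •
        FreeAbelianGroup.of ⟨T', hT', p', DendroidalSet.restrict τ.hom x⟩) : Chun X n) = 0 :=
    (QuotientAddGroup.eq_zero_iff _).2
      (AddSubgroup.subset_closure ⟨T, T', hT, hT', p, p', τ, x, rfl⟩)
  rw [QuotientAddGroup.mk_sub, sub_eq_zero] at h
  exact h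

/-- The case of an identity isomorphism. Together with `cls_iso`, where the planar structure is
transported along and the sign is `1`, it splits the defining relation into two that are easier to
check for `faceSum`. -/
theorem cls_planar {n : ℕ} {T : Tree} (hT : T.size = n) (p p' : Planar T)
    (x : X.obj (Opposite.op T)) :
    PlanarDendrex.cls ⟨T, hT, p, x⟩ =
      ((Planar.sgn p' p : ℤˣ) : ℤ) • PlanarDendrex.cls ⟨T, hT, p', x⟩ := by
  have h := cls_eq_sgn_smul hT hT p p' (Iso.refl T) x
  rwa [Iso.refl_hom, Planar.pullback_id, DendroidalSet.restrict_id] at h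

theorem cls_iso {n : ℕ} {T T' : Tree} (hT : T.size = n) (hT' : T'.size = n)
    (p : Planar T) (τ : T' ≅ T) (x : X.obj (Opposite.op T)) :
    PlanarDendrex.cls ⟨T, hT, p, x⟩ =
      PlanarDendrex.cls ⟨T', hT', Planar.pullback τ.hom p, DendroidalSet.restrict τ.hom x⟩ := by
  rw [cls_eq_sgn_smul hT hT' p (Planar.pullback τ.hom p) τ x, Planar.sgn_self, Units.val_one,
    one_smul]

/-- The two embeddings differ by an isomorphism over `T`, and both the planar structures and the
dendrices are restricted from `T`, so that this isomorphism matches them with sign `1`. -/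
theorem cls_eq_of_embeddings {n : ℕ} {S S' T : Tree} (hS : S.size = n) (hS' : S'.size = n)
    {f : S ⟶ T} {g : S' ⟶ T} (hf : Function.Injective (edgeMap f))
    (hg : Function.Injective (edgeMap g)) (hr : Set.range (edgeMap f) = Set.range (edgeMap g))
    (ho : Set.range (fun v => edgeMap f (S.out v)) = Set.range (fun v => edgeMap g (S'.out v)))
    (p : Planar T) (x : X.obj (Opposite.op T)) :
    PlanarDendrex.cls ⟨S, hS, Planar.pullback f p, DendroidalSet.restrict f x⟩ =
      PlanarDendrex.cls ⟨S', hS', Planar.pullback g p, DendroidalSet.restrict g x⟩ := by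
  obtain ⟨α, hα⟩ := exists_iso_of_embeddings hf hg (fun _ _ => below_edgeMap_iff hf)
    (fun _ _ => below_edgeMap_iff hg) hr ho
  obtain rfl : α.hom ≫ g = f := hom_ext hα
  rw [cls_iso hS' hS _ α, Planar.pullback_comp, DendroidalSet.restrict_comp]

/-! ### The differential -/

/-- The signed sum of the elementary faces. -/
noncomputable def faceSum {n : ℕ} (g : PlanarDendrex X (n + 1)) : Chun X n :=
  ∑ f : g.tree.Face, f.sgn g.planar • (g.face f).cls

/-- For each face the factor by which `sgn(p', p)` changes on leaving out the vertex equals the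
quotient of the two face signs, so the identity holds term by term. -/
theorem faceSum_planar {n : ℕ} {T : Tree} (hT : T.size = n + 1) (p p' : Planar T)
    (x : X.obj (Opposite.op T)) :
    faceSum ⟨T, hT, p, x⟩ = ((Planar.sgn p' p : ℤˣ) : ℤ) • faceSum ⟨T, hT, p', x⟩ := by
  rw [faceSum, faceSum, Finset.smul_sum]
  refine Finset.sum_congr rfl fun f _ => ?_
  change f.sgn p • PlanarDendrex.cls ⟨f.tree, _, Planar.pullback f.incl p, _⟩ = _ • f.sgn p' •
    PlanarDendrex.cls ⟨f.tree, _, Planar.pullback f.incl p', _⟩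
  rw [cls_planar _ (Planar.pullback f.incl p) (Planar.pullback f.incl p'), smul_smul, smul_smul,
    Planar.sgn_pullback f.incl_injective p p' f.range_vert, Face.sgn_eq, Face.sgn_eq]
  congr 1
  -- The power for `p'` occurs once in the face sign and once in `sgn(p', p)`, and cancels.
  have h : ((-1 : ℤ) ^ p'.label f.vertex) * (-1 : ℤ) ^ p'.label f.vertex = 1 := by
    rw [← mul_pow]; simp
  push_cast
  rw [pow_add]
  linear_combination (-(f.kind.sgn * (-1) ^ p.label f.vertex *
    ((Planar.sgn (Planar.pullback f.incl p') (Planar.pullback f.incl p) : ℤˣ) : ℤ))) * h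

/-- Corresponding faces of `T'` and `T` are both embedded in `T`, with the same edges and vertex
outputs; labels and kind signs are invariant under isomorphisms. -/
theorem faceSum_iso {n : ℕ} {T T' : Tree} (hT : T.size = n + 1) (hT' : T'.size = n + 1)
    (p : Planar T) (τ : T' ≅ T) (x : X.obj (Opposite.op T)) :
    faceSum ⟨T, hT, p, x⟩ =
      faceSum ⟨T', hT', Planar.pullback τ.hom p, DendroidalSet.restrict τ.hom x⟩ := by
  have hi := edgeMap_iso_injective τ
  rw [faceSum, faceSum]
  refine ((Face.mapIso_bijective τ).sum_comp _).symm.trans (Finset.sum_congr rfl fun f _ => ?_)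
  have hsgn : (f.mapIso τ).sgn p = f.sgn (Planar.pullback τ.hom p) := by
    rw [Face.sgn_eq, Face.sgn_eq, Face.vertex_mapIso, Face.kind_mapIso, FaceKind.sgn_map,
      Planar.label_pullback_iso]
  have hfi : Function.Injective (edgeMap (f.incl ≫ τ.hom)) := hi.comp f.incl_injective
  have hcls := cls_eq_of_embeddings ((f.mapIso τ).size_tree hT) (f.size_tree hT')
    (f.mapIso τ).incl_injective hfi ?_ ?_ p x
  · change (f.mapIso τ).sgn p • PlanarDendrex.cls ⟨(f.mapIso τ).tree, _,
      Planar.pullback (f.mapIso τ).incl p, DendroidalSet.restrict (f.mapIso τ).incl x⟩ = _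
    rw [hcls, hsgn, Planar.pullback_comp, DendroidalSet.restrict_comp]
    rfl
  · rw [Face.range_incl, Face.vertex_mapIso, Face.kind_mapIso, removedEdges_iso]
    change _ = Set.range (edgeMap τ.hom ∘ edgeMap f.incl)
    rw [Set.range_comp, Face.range_incl,
      Set.image_compl_eq ⟨hi, edgeMap_iso_surjective τ⟩]
  · rw [Face.range_out_incl, Face.vertex_mapIso, range_out_eq _ hfi]
    congr 1
    rw [← Set.image_singleton, ← Set.image_compl_eq ⟨vertMap_injective _ hi,
      vertMap_iso_surjective τ⟩, ← Face.range_vert, ← Set.range_comp]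
    exact congrArg Set.range (funext fun v => (vertMap_comp _ _ f.incl_injective hi hfi v).symm)

/-- The differential of the complex. -/
noncomputable def differential (X : DendroidalSet.{u}) (n : ℕ) : Chun X (n + 1) →+ Chun X n :=
  QuotientAddGroup.lift (A X (n + 1)) (FreeAbelianGroup.lift faceSum) <| by
    rw [A, AddSubgroup.closure_le]
    rintro _ ⟨T, T', hT, hT', p, p', τ, x, rfl⟩
    rw [SetLike.mem_coe, AddMonoidHom.mem_ker, map_sub, map_zsmul, FreeAbelianGroup.lift_apply_of,
      FreeAbelianGroup.lift_apply_of, sub_eq_zero, faceSum_iso hT hT' p τ x,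
      faceSum_planar hT' (Planar.pullback τ.hom p) p']

theorem isFaceDifferential_differential (X : DendroidalSet.{u}) :
    IsFaceDifferential X (differential X) := fun _ g => FreeAbelianGroup.lift_apply_of faceSum g

/-- The classes generate. This gives the uniqueness of `d` and reduces `d ∘ d = 0` to a single
triple. -/
theorem chun_hom_ext {n : ℕ} {B : Type*} [AddCommGroup B] {φ ψ : Chun X n →+ B}
    (h : ∀ g : PlanarDendrex X n, φ g.cls = ψ g.cls) : φ = ψ :=
  QuotientAddGroup.addMonoidHom_ext _ (FreeAbelianGroup.lift_ext _ _ h)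

namespace Tree

/-! ### Pairs of successive elementary faces -/

/-- The combinatorial description of a pair of successive elementary faces of a tree `T`: the first
one leaves out the vertex `w` and the second one the vertex `x`. -/
@[ext] structure FacePair (T : Tree) where
  w : T.Vert
  k : FaceKind T.Edge
  x : T.Vert
  l : FaceKind T.Edge

namespace FacePair

variable {T : Tree}

/-- The root of the first face. -/
def root (c : T.FacePair) : T.Edge :=
  match c.k with
  | .bottom e => e
  | _ => T.root

/-- The inputs of the vertex `x` in the first face. -/
def ins (c : T.FacePair) : Set T.Edge :=
  match c.k with
  | .inner => {a | a ≠ T.out c.w ∧ (a ∈ T.ins c.x ∨ T.out c.w ∈ T.ins c.x ∧ a ∈ T.ins c.w)}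
  | _ => T.ins c.x

/-- The leaves of the first face. -/
def IsLeaf (c : T.FacePair) (a : T.Edge) : Prop := ∀ u, T.out u = a → u = c.w

/-- The condition for the existence of the second face. -/
def IsSndFace (c : T.FacePair) : Prop :=
  match c.l with
  | .inner => T.out c.x ≠ c.root
  | .top => ∀ a ∈ c.ins, c.IsLeaf a
  | .bottom e => T.out c.x = c.root ∧ e ∈ c.ins ∧ ∀ a ∈ c.ins, a ≠ e → c.IsLeaf a

/-- The condition for the existence of a pair of faces. -/
def IsValid (c : T.FacePair) : Prop := T.IsFace c.w c.k ∧ c.x ≠ c.w ∧ c.IsSndFace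

/-- The edges left out by the second face. -/
def removedSnd (c : T.FacePair) : Set T.Edge :=
  match c.l with
  | .inner => {T.out c.x}
  | .top => c.ins
  | .bottom e => insert (T.out c.x) (c.ins \ {e})

/-- The edges left out by a pair of faces. -/
def removed (c : T.FacePair) : Set T.Edge := T.removedEdges c.w c.k ∪ c.removedSnd

/-- The pair with the two faces interchanged. -/
def swap (c : T.FacePair) : T.FacePair := ⟨c.x, c.l, c.w, c.k⟩

open Classical in
/-- The other pair of faces with the same composition. -/
noncomputable def partner (c : T.FacePair) : T.FacePair :=
  match c.k, c.l with
  | .inner, .top => if T.out c.w ∈ T.ins c.x then ⟨c.w, .top, c.x, .top⟩ else c.swap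
  | .top, .top => if T.out c.w ∈ T.ins c.x then ⟨c.w, .inner, c.x, .top⟩ else c.swap
  | .inner, .bottom e =>
    if T.out c.w ∈ T.ins c.x then
      if e ∈ T.ins c.w then ⟨c.x, .bottom (T.out c.w), c.w, .bottom e⟩
      else ⟨c.w, .top, c.x, .bottom e⟩
    else c.swap
  | .top, .bottom e =>
    if T.out c.w ∈ T.ins c.x ∧ e ≠ T.out c.w then ⟨c.w, .inner, c.x, .bottom e⟩ else c.swap
  | .bottom _, .bottom e => ⟨c.x, .inner, c.w, .bottom e⟩
  | _, _ => c.swap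

/-- If `w` sits directly on `x`, chopping off the vertex merged from both can be replaced by
chopping off one after the other: top after top, bottom after bottom, or bottom after top, depending
on which edge is kept. In the remaining configurations the two faces can be done in either order.
Given the tree axioms, each combination of kinds is a finite check. -/
theorem isValid_partner {c : T.FacePair} (hc : c.IsValid) : c.partner.IsValid := by
  have h1 := @T.out_inj
  have h2 := @T.ins_unique
  have h3 := @out_notMem_ins T
  have h4 : ∀ v, T.root ∉ T.ins v := fun v hv => (T.exists_ins_iff _).1 ⟨v, hv⟩ rfl
  obtain ⟨w, k, x, l⟩ := c
  cases k <;> cases l <;> simp only [partner, swap] <;> (try split_ifs) <;>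
    simp only [IsValid, IsFace, IsSndFace, root, ins, IsLeaf, Tree.IsLeaf, Set.mem_ofPred_eq,
      and_imp, or_imp, forall_and]
      at hc ⊢ <;> grind +splitImp

theorem removed_partner {c : T.FacePair} (hc : c.IsValid) : c.partner.removed = c.removed := by
  have h1 := @T.out_inj
  have h2 := @T.ins_unique
  have h3 := @out_notMem_ins T
  have h4 : ∀ v, T.root ∉ T.ins v := fun v hv => (T.exists_ins_iff _).1 ⟨v, hv⟩ rfl
  obtain ⟨w, k, x, l⟩ := c
  ext a
  cases k <;> cases l <;> simp only [partner, swap] <;> (try split_ifs) <;>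
    simp only [IsValid, IsFace, IsSndFace, root, ins, IsLeaf, Tree.IsLeaf, Set.mem_ofPred_eq,
      removed, removedSnd, removedEdges, Set.mem_union, Set.mem_insert_iff, Set.mem_sdiff,
      Set.mem_singleton_iff] at hc ⊢ <;> grind +splitImp

theorem partner_partner {c : T.FacePair} (hc : c.IsValid) : c.partner.partner = c := by
  have h2 := @T.ins_unique
  have h3 := @out_notMem_ins T
  obtain ⟨w, k, x, l⟩ := c
  cases k <;> cases l <;>
    simp only [IsValid, IsFace, IsSndFace, root, ins, IsLeaf, Tree.IsLeaf, Set.mem_ofPred_eq]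
      at hc ⊢ <;> simp only [partner, swap] <;> (try split_ifs) <;> grind +splitImp

theorem vertices_partner (c : T.FacePair) :
    ({c.partner.w, c.partner.x} : Set T.Vert) = {c.w, c.x} := by
  obtain ⟨w, k, x, l⟩ := c
  cases k <;> cases l <;> simp only [partner, swap] <;> (try split_ifs) <;>
    first | rfl | exact Set.pair_comm _ _

open Classical in
/-- The product of the signs of a pair of faces. -/
noncomputable def sgn (p : Planar T) (c : T.FacePair) : ℤ :=
  c.k.sgn * c.l.sgn *
    (-1) ^ (p.label c.w + p.label c.x + if p.Before c.w c.x then 1 else 0)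

/-- Where the two vertices trade places, the product of the kind signs is unchanged and `[w before
x]` flips. Where they keep their places, an inner face is exchanged with a top face, and only the
kind sign flips. -/
theorem sgn_partner (p : Planar T) {c : T.FacePair} (hc : c.x ≠ c.w) :
    c.partner.sgn p = - c.sgn p := by
  classical
  have hb := p.not_before_iff hc
  obtain ⟨w, k, x, l⟩ := c
  cases k <;> cases l <;> simp only [partner, swap] <;> (try split_ifs) <;>
    simp only [sgn, FaceKind.sgn] <;> by_cases h : p.Before x w <;> simp_all [pow_add, mul_comm]

end FacePair

end Tree
namespace Tree

/-! ### Successive faces as combinatorial pairs -/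

namespace Face

variable {T : Tree}

/-- The pair of two successive elementary faces. -/
noncomputable def pair (f : T.Face) (g : f.tree.Face) : T.FacePair :=
  ⟨f.vertex, f.kind, f.vert g.vertex, g.kind.map (edgeMap f.incl)⟩

theorem incl_root (f : T.Face) (x : T.Vert) (l : FaceKind T.Edge) :
    edgeMap f.incl f.tree.root = FacePair.root ⟨f.vertex, f.kind, x, l⟩ := by
  cases f <;> rfl

theorem image_ins (f : T.Face) (u : f.tree.Vert) (l : FaceKind T.Edge) :
    edgeMap f.incl '' f.tree.ins u = FacePair.ins ⟨f.vertex, f.kind, f.vert u, l⟩ := by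
  ext a
  cases f with
  | inner v w h =>
    obtain ⟨u, hu⟩ := u
    rw [show (Face.inner v w h).vert ⟨u, hu⟩ = u from T.out_inj (out_vert _ _)]
    -- `FacePair` does not record the lower vertex of an inner face; it is recognised by having `out
    -- w` as an input.
    have huv : T.out w ∈ T.ins u ↔ u = v := ⟨fun h' => T.ins_unique h' h, fun h' => h' ▸ h⟩
    constructor
    · rintro ⟨b, hb, rfl⟩
      exact ⟨b.2, hb.imp_right fun hb => ⟨huv.2 hb.1, hb.2⟩⟩
    · rintro ⟨h1, h2⟩
      exact ⟨⟨a, h1⟩, h2.imp_right fun h2 => ⟨huv.1 h2.1, h2.2⟩, rfl⟩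
  | top w h =>
    obtain ⟨u, hu⟩ := u
    rw [show (Face.top w h).vert ⟨u, hu⟩ = u from T.out_inj (out_vert _ _)]
    constructor
    · rintro ⟨b, hb, rfl⟩
      exact hb
    · exact fun h1 => ⟨⟨a, fun h2 => hu (T.ins_unique h1 h2)⟩, h1, rfl⟩
  | bottom v e hv he h =>
    obtain ⟨u, hu⟩ := u
    rw [show (Face.bottom v e hv he h).vert ⟨u, hu⟩ = u from T.out_inj (out_vert _ _)]
    constructor
    · rintro ⟨b, hb, rfl⟩
      exact hb
    · exact fun h1 => ⟨⟨a, (T.exists_ins_iff a).1 ⟨u, h1⟩,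
        fun h2 => absurd (T.ins_unique h1 h2) hu⟩, h1, rfl⟩

/-- The vertices of the face are all vertices of `T` but one, so a surviving edge is a leaf of the
face iff at most the omitted vertex has it as output. -/
theorem incl_isLeaf_iff (f : T.Face) (a : f.tree.Edge) (x : T.Vert) (l : FaceKind T.Edge) :
    FacePair.IsLeaf ⟨f.vertex, f.kind, x, l⟩ (edgeMap f.incl a) ↔ f.tree.IsLeaf a := by
  constructor
  · rintro h u rfl
    exact f.vert_ne u (h _ (f.out_vert u))
  · intro h u hu
    by_contra hne
    obtain ⟨v, rfl⟩ := f.exists_vert_eq hne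
    rw [out_vert, f.incl_injective.eq_iff] at hu
    exact h v hu

theorem isSndFace_iff (f : T.Face) (u : f.tree.Vert) (k : FaceKind f.tree.Edge) :
    FacePair.IsSndFace ⟨f.vertex, f.kind, f.vert u, k.map (edgeMap f.incl)⟩ ↔
      f.tree.IsFace u k := by
  cases k with
  | inner =>
    simp only [FacePair.IsSndFace, FaceKind.map, ← f.incl_root, out_vert, IsFace,
      f.incl_injective.ne_iff]
  | top =>
    simp only [FacePair.IsSndFace, FaceKind.map, IsFace, ← f.image_ins, Set.forall_mem_image,
      f.incl_isLeaf_iff]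
  | bottom e =>
    simp only [FacePair.IsSndFace, FaceKind.map, IsFace, ← f.image_ins, Set.forall_mem_image,
      f.incl_isLeaf_iff, ← f.incl_root, out_vert, f.incl_injective.eq_iff,
      f.incl_injective.mem_set_image, f.incl_injective.ne_iff]

theorem isValid_pair (f : T.Face) (g : f.tree.Face) : (f.pair g).IsValid :=
  ⟨f.isFace, f.vert_ne _, (f.isSndFace_iff _ _).2 g.isFace⟩

theorem exists_pair_eq {c : T.FacePair} (hc : c.IsValid) :
    ∃ (f : T.Face) (g : f.tree.Face), f.pair g = c := by
  obtain ⟨w, k, x, l⟩ := c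
  obtain ⟨h1, h2, h3⟩ := hc
  obtain ⟨f, rfl, rfl⟩ := exists_of_isFace h1
  obtain ⟨u, rfl⟩ := f.exists_vert_eq h2
  obtain ⟨k, rfl⟩ : ∃ k : FaceKind f.tree.Edge, k.map (edgeMap f.incl) = l := by
    cases l with
    | inner => exact ⟨.inner, rfl⟩
    | top => exact ⟨.top, rfl⟩
    | bottom e =>
      -- The kept edge is an input of the second vertex in the first face, and therefore survives
      -- the first face.
      have he : e ∈ edgeMap f.incl '' f.tree.ins u := (f.image_ins u _).symm ▸ h3.2.1
      obtain ⟨a, -, rfl⟩ := he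
      exact ⟨.bottom a, rfl⟩
  obtain ⟨g, rfl, rfl⟩ := exists_of_isFace ((f.isSndFace_iff _ _).1 h3)
  exact ⟨f, g, rfl⟩

theorem pair_injective :
    Function.Injective (fun q : Σ f : T.Face, f.tree.Face => q.1.pair q.2) := by
  rintro ⟨f, g⟩ ⟨f', g'⟩ h
  obtain ⟨h1, h2, h3, h4⟩ := FacePair.ext_iff.1 h
  obtain rfl : f = f' := ext_vertex_kind h1 h2
  obtain rfl : g = g' :=
    ext_vertex_kind (f.vert_injective h3) (FaceKind.map_injective f.incl_injective h4)
  rfl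

theorem range_pair_incl (f : T.Face) (g : f.tree.Face) :
    Set.range (edgeMap (g.incl ≫ f.incl)) = (f.pair g).removedᶜ := by
  have h : (f.pair g).removedSnd =
      edgeMap f.incl '' f.tree.removedEdges g.vertex g.kind := by
    rw [pair, FacePair.removedSnd]
    cases g.kind with
    | inner => simp only [FaceKind.map, removedEdges, Set.image_singleton, out_vert]
    | top => simp only [FaceKind.map, removedEdges, ← f.image_ins]
    | bottom e =>
      simp only [FaceKind.map, removedEdges, ← f.image_ins, Set.image_insert_eq,
        Set.image_sdiff f.incl_injective, Set.image_singleton, out_vert]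
  rw [FacePair.removed, h, Set.compl_union]
  change Set.range (edgeMap f.incl ∘ edgeMap g.incl) = (T.removedEdges f.vertex f.kind)ᶜ ∩ _
  rw [← range_incl, Set.range_comp, range_incl, Set.image_compl_eq_range_sdiff_image
    f.incl_injective]
  rfl

theorem pair_incl_injective (f : T.Face) (g : f.tree.Face) :
    Function.Injective (edgeMap (g.incl ≫ f.incl)) :=
  f.incl_injective.comp g.incl_injective

theorem range_out_pair (f : T.Face) (g : f.tree.Face) :
    Set.range (fun v => edgeMap (g.incl ≫ f.incl) (g.tree.out v)) =
      T.out '' {(f.pair g).w, (f.pair g).x}ᶜ := by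
  rw [range_out_eq _ (f.pair_incl_injective g)]
  congr 1
  have h : vertMap (g.incl ≫ f.incl) (f.pair_incl_injective g) = f.vert ∘ g.vert :=
    funext fun v => vertMap_comp _ _ g.incl_injective f.incl_injective _ v
  rw [h, Set.range_comp, range_vert, Set.image_compl_eq_range_sdiff_image f.vert_injective,
    range_vert, Set.image_singleton, Set.insert_eq, Set.compl_union]
  rfl

/-- In the first face the label of the second vertex has dropped by one if the omitted vertex came
before it; this is the origin of the indicator in the exponent, where only the parity counts. -/
theorem sgn_pair (p : Planar T) (f : T.Face) (g : f.tree.Face) :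
    f.sgn p * g.sgn (Planar.pullback f.incl p) = (f.pair g).sgn p := by
  classical
  rw [sgn_eq, sgn_eq]
  have h : (Planar.pullback f.incl p).label g.vertex +
      (if p.Before f.vertex (f.vert g.vertex) then 1 else 0) = p.label (f.vert g.vertex) :=
    Planar.label_pullback_add f.incl_injective p f.range_vert g.vertex
  have hs : (f.pair g).sgn p = f.kind.sgn * (g.kind.map (edgeMap f.incl)).sgn *
      (-1) ^ (p.label f.vertex + p.label (f.vert g.vertex) +
        if p.Before f.vertex (f.vert g.vertex) then 1 else 0) := rfl
  rw [hs, FaceKind.sgn_map, ← h]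
  split_ifs <;> ring

/-- The other pair of faces with the same composition. -/
noncomputable def partner (q : Σ f : T.Face, f.tree.Face) : Σ f : T.Face, f.tree.Face :=
  have h := exists_pair_eq (FacePair.isValid_partner (q.1.isValid_pair q.2))
  ⟨h.choose, h.choose_spec.choose⟩

theorem pair_partner (q : Σ f : T.Face, f.tree.Face) :
    (partner q).1.pair (partner q).2 = (q.1.pair q.2).partner :=
  (exists_pair_eq (FacePair.isValid_partner (q.1.isValid_pair q.2))).choose_spec.choose_spec

end Face

end Tree

/-! ### The square of the differential -/

open Dendroidal.Tree

variable {X : DendroidalSet.{u}}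

/-- Partners remove the same edges and the same two vertices, so the composite inclusions are
embeddings with equal images. -/
theorem cls_face_partner {n : ℕ} (g : PlanarDendrex X (n + 1 + 1))
    (q : Σ f : g.tree.Face, f.tree.Face) :
    ((g.face (Face.partner q).1).face (Face.partner q).2).cls = ((g.face q.1).face q.2).cls := by
  have h := cls_eq_of_embeddings
    ((Face.partner q).2.size_tree ((Face.partner q).1.size_tree g.size_tree))
    (q.2.size_tree (q.1.size_tree g.size_tree))
    ((Face.partner q).1.pair_incl_injective (Face.partner q).2)
    (q.1.pair_incl_injective q.2)
    (by rw [Face.range_pair_incl, Face.range_pair_incl, Face.pair_partner,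
      FacePair.removed_partner (q.1.isValid_pair q.2)])
    (by rw [Face.range_out_pair, Face.range_out_pair, Face.pair_partner,
      FacePair.vertices_partner]) g.planar g.dendrex
  rwa [Planar.pullback_comp, Planar.pullback_comp, DendroidalSet.restrict_comp,
    DendroidalSet.restrict_comp] at h

theorem IsFaceDifferential.comp_eq_zero {d : ∀ n : ℕ, Chun X (n + 1) →+ Chun X n}
    (hd : IsFaceDifferential X d) (n : ℕ) : (d n).comp (d (n + 1)) = 0 := by
  classical
  refine chun_hom_ext fun g => ?_
  rw [AddMonoidHom.comp_apply, hd, map_sum, AddMonoidHom.zero_apply]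
  have h : ∀ f : g.tree.Face, d n (f.sgn g.planar • (g.face f).cls) =
      ∑ f' : f.tree.Face, (f.pair f').sgn g.planar • ((g.face f).face f').cls := by
    intro f
    rw [map_zsmul, hd, Finset.smul_sum]
    refine Finset.sum_congr rfl fun f' _ => ?_
    rw [smul_smul]
    exact congrArg (· • _) (Face.sgn_pair g.planar f f')
  rw [Finset.sum_congr rfl fun f _ => h f, Finset.sum_sigma']
  have hsgn : ∀ q : Σ f : g.tree.Face, f.tree.Face,
      ((Face.partner q).1.pair (Face.partner q).2).sgn g.planar =
        - (q.1.pair q.2).sgn g.planar := fun q => by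
    rw [Face.pair_partner, FacePair.sgn_partner _ (q.1.isValid_pair q.2).2.1]
  refine Finset.sum_involution (fun q _ => Face.partner q) ?_ ?_ ?_ ?_
  · intro q _
    rw [cls_face_partner, hsgn, neg_smul, add_neg_cancel]
  · intro q _ _ hq
    -- At a fixed point the sign would equal its own negative, but it is a nonzero integer.
    have h1 := hsgn q
    rw [hq] at h1
    have h2 : (q.1.pair q.2).sgn g.planar ≠ 0 := by
      rw [FacePair.sgn]
      refine mul_ne_zero (mul_ne_zero ?_ ?_) (pow_ne_zero _ (by norm_num))
      · cases (q.1.pair q.2).k <;> simp [FaceKind.sgn]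
      · cases (q.1.pair q.2).l <;> simp [FaceKind.sgn]
    omega
  · exact fun _ _ => Finset.mem_univ _
  · intro q _
    refine Face.pair_injective ?_
    change (Face.partner (Face.partner q)).1.pair _ = _
    rw [Face.pair_partner, Face.pair_partner,
      FacePair.partner_partner (q.1.isValid_pair q.2)]

namespace Tree

/-! ### The trees `σ_e S` -/

section Degeneracy

variable {S : Tree} {e : S.Edge}

theorem degen_out_some_of_eq {v : S.Vert} (h : S.out v = e) :
    (S.degen e).out (some v) = none := if_pos h

theorem degen_out_some_of_ne {v : S.Vert} (h : S.out v ≠ e) :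
    (S.degen e).out (some v) = some (S.out v) := if_neg h

theorem degen_out_some_eq_none_iff {v : S.Vert} :
    (S.degen e).out (some v) = none ↔ S.out v = e := by
  refine ⟨fun h => ?_, degen_out_some_of_eq⟩
  by_contra hne
  exact Option.some_ne_none _ ((degen_out_some_of_ne hne).symm.trans h)

theorem degen_out_some_eq_some_iff {v : S.Vert} {a : S.Edge} :
    (S.degen e).out (some v) = some a ↔ S.out v = a ∧ a ≠ e := by
  by_cases h : S.out v = e
  · rw [degen_out_some_of_eq h]
    exact ⟨fun h' => absurd h'.symm (Option.some_ne_none a), fun h' => absurd (h'.1.symm.trans h) h'.2⟩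
  · rw [degen_out_some_of_ne h]
    exact ⟨fun h' => ⟨Option.some.inj h', Option.some.inj h' ▸ h⟩, fun h' => congrArg some h'.1⟩

theorem some_mem_degen_ins {v : S.Vert} {a : S.Edge} :
    (some a : Option S.Edge) ∈ (S.degen e).ins (some v) ↔ a ∈ S.ins v :=
  (Option.some_injective _).mem_set_image

theorem edgeMap_degenMap_out_some (v : S.Vert) :
    edgeMap (S.degenMap e) ((S.degen e).out (some v)) = S.out v := by
  by_cases h : S.out v = e
  · rw [degen_out_some_of_eq h]
    exact h.symm
  · rw [degen_out_some_of_ne h]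
    rfl

theorem degen_below_copy : (S.degen e).Below (some e) none :=
  Relation.ReflTransGen.single ⟨none, rfl, rfl⟩

theorem degen_below_some_some {a b : S.Edge} :
    (S.degen e).Below (some a) (some b) ↔ S.Below a b := by
  refine ⟨fun h => edgeMap_below (S.degenMap e) h, fun h => ?_⟩
  induction h with
  | refl => exact below_refl _
  | tail _ hs ih =>
    obtain ⟨v, hv, rfl⟩ := hs
    refine below_trans ?_ ih
    have h1 : (S.degen e).Below ((S.degen e).out (some v)) (some _) :=
      out_below (some_mem_degen_ins.2 hv)
    by_cases h : S.out v = e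
    · rw [degen_out_some_of_eq h] at h1
      exact below_trans (h ▸ degen_below_copy) h1
    · rwa [degen_out_some_of_ne h] at h1

theorem degen_below_none_some {b : S.Edge} :
    (S.degen e).Below none (some b) ↔ S.Below e b ∧ b ≠ e := by
  constructor
  · intro h
    refine ⟨edgeMap_below (S.degenMap e) h, ?_⟩
    rintro rfl
    exact Option.some_ne_none _ (below_antisymm degen_below_copy h)
  · rintro ⟨h, hne⟩
    rcases Relation.ReflTransGen.cases_tail h with h1 | ⟨c, hc, ⟨v, hv, hve⟩⟩
    · exact absurd h1.symm hne
    · have h1 : (S.degen e).Below ((S.degen e).out (some v)) (some c) :=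
        out_below (some_mem_degen_ins.2 hv)
      rw [degen_out_some_of_eq hve] at h1
      exact below_trans h1 (degen_below_some_some.2 hc)

theorem degen_below_some_none {a : S.Edge} :
    (S.degen e).Below (some a) none ↔ S.Below a e :=
  ⟨fun h => edgeMap_below (S.degenMap e) h,
    fun h => below_trans (degen_below_some_some.2 h) degen_below_copy⟩

theorem degen_below_none_iff {a : (S.degen e).Edge} :
    (S.degen e).Below a none ↔ a = none ∨ (S.degen e).Below a (some e) := by
  cases a with
  | none => exact ⟨fun _ => Or.inl rfl, fun _ => below_refl _⟩
  | some a =>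
    rw [degen_below_some_none]
    exact ⟨fun h => Or.inr (degen_below_some_some.2 h),
      fun h => degen_below_some_some.1 (h.resolve_left (Option.some_ne_none a))⟩

/-- The vertex between `e` and its copy is unary, so nothing branches off between them. -/
theorem degen_below_of_below_some {b : (S.degen e).Edge} (h : (S.degen e).Below (some e) b) :
    (S.degen e).Below b none ∨ (S.degen e).Below none b := by
  cases b with
  | none => exact Or.inl (below_refl _)
  | some b =>
    by_cases hb : b = e
    · exact Or.inl (hb ▸ degen_below_copy)
    · exact Or.inr (degen_below_none_some.2 ⟨degen_below_some_some.1 h, hb⟩)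

/-! ### Planar structures on `σ_e S` -/

variable (p : Planar (S.degen e))

/-- Edges comparable with `e` are comparable with its copy, so `e` and `b` cannot be comparable
here; the left-right order does not distinguish the two copies. -/
theorem left_none_iff {b : (S.degen e).Edge} : p.Left none b ↔ p.Left (some e) b := by
  refine ⟨fun h => ?_, fun h => h.mono degen_below_copy (below_refl _)⟩
  rcases p.left_total (a := (some e : Option S.Edge)) (b := b)
    (fun h' => (degen_below_of_below_some h').elim h.not_below.2 h.not_below.1)
    (fun h' => h.not_below.2 (below_trans h' degen_below_copy)) with h1 | h1
  · exact h1
  · exact absurd (h1.mono (below_refl _) degen_below_copy) h.asymm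

theorem left_iff_none {b : (S.degen e).Edge} : p.Left b none ↔ p.Left b (some e) := by
  refine ⟨fun h => ?_, fun h => h.mono (below_refl _) degen_below_copy⟩
  rcases p.left_total (a := b) (b := (some e : Option S.Edge))
    (fun h' => h.not_below.1 (below_trans h' degen_below_copy))
    (fun h' => (degen_below_of_below_some h').elim h.not_below.1 h.not_below.2) with h1 | h1
  · exact h1
  · exact absurd (h1.mono degen_below_copy (below_refl _)) h.asymm

theorem left_iff_left_degenMap {a b : (S.degen e).Edge} :
    p.Left a b ↔ p.Left (some (edgeMap (S.degenMap e) a)) (some (edgeMap (S.degenMap e) b)) := by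
  have h1 : p.Left a b ↔ p.Left (some (edgeMap (S.degenMap e) a)) b := by
    cases a with
    | none => exact left_none_iff p
    | some a => exact Iff.rfl
  rw [h1]
  cases b with
  | none => exact left_iff_none p
  | some b => exact Iff.rfl

/-- Sections of a degeneracy map induce the same planar structure. -/
theorem pullback_eq_of_comp_degenMap_eq {R : Tree} {f g : R ⟶ S.degen e}
    (h : f ≫ S.degenMap e = g ≫ S.degenMap e) : Planar.pullback f p = Planar.pullback g p := by
  have h' : ∀ a, edgeMap (S.degenMap e) (edgeMap f a) = edgeMap (S.degenMap e) (edgeMap g a) :=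
    fun a => by rw [← edgeMap_comp, h, edgeMap_comp]
  ext v i j
  change p.Left (edgeMap f i) (edgeMap f j) ↔ p.Left (edgeMap g i) (edgeMap g j)
  rw [left_iff_left_degenMap, h', h', ← left_iff_left_degenMap]

/-- The vertex above the new unary vertex gets the next label. -/
theorem label_eq_label_none_add_one {w : S.Vert} (hw : S.out w = e) :
    p.label (some w) = p.label none + 1 := by
  have ho : (S.degen e).out (some w) = none := degen_out_some_of_eq hw
  have ho' : (S.degen e).out none = some e := rfl
  -- The unary vertex is immediately below `some w` and has no other branch, so it is the only
  -- additional predecessor.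
  have h : {u | p.Before u (some w)} = insert none {u | p.Before u none} := by
    ext u
    have hu : u ≠ some w ↔ (S.degen e).out u ≠ none := by
      rw [← ho]
      exact not_congr ⟨fun h => congrArg _ h, fun h => (S.degen e).out_inj h⟩
    have hn : ¬ (S.degen e).Below none (some e) := fun h => (degen_below_none_some.1 h).2 rfl
    have hu' : u = none ∨ u ≠ none := em _
    have hB : ∀ x y, p.Before x y ↔ (x ≠ y ∧ (S.degen e).Below ((S.degen e).out x)
        ((S.degen e).out y)) ∨ p.Left ((S.degen e).out x) ((S.degen e).out y) :=
      fun _ _ => Iff.rfl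
    refine (hB u (some w)).trans (Iff.trans ?_ (or_congr_right (hB u none)).symm)
    rw [ho, ho', hu, left_iff_none, degen_below_none_iff]
    constructor
    · rintro (⟨h1, h2⟩ | h1)
      · exact hu'.imp_right fun h3 => Or.inl ⟨h3, h2.resolve_left h1⟩
      · exact Or.inr (Or.inr h1)
    · rintro (rfl | ⟨-, h1⟩ | h1)
      · exact Or.inl ⟨Option.some_ne_none e, Or.inr (below_refl _)⟩
      · exact Or.inl ⟨fun h2 => hn (h2 ▸ h1), Or.inr h1⟩
      · exact Or.inr h1
  change Set.ncard {u | p.Before u (some w)} = Set.ncard {u | p.Before u none} + 1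
  rw [h]
  exact Set.ncard_insert_of_notMem (fun h' => Planar.Before.irrefl (p := p) h') (Set.toFinite _)

/-! ### The two faces which are sections of a degeneracy map -/

/-- The face of `σ_e S` leaving out the copy of `e`. -/
def IsUpperSection (f : (S.degen e).Face) : Prop :=
  (∃ w, S.out w = e ∧ f.vertex = some w ∧ f.kind = .inner) ∨
    ((∀ w, S.out w ≠ e) ∧ f.vertex = none ∧ f.kind = .top)

/-- The face of `σ_e S` leaving out `e`. -/
def IsLowerSection (f : (S.degen e).Face) : Prop :=
  (e ≠ S.root ∧ f.vertex = none ∧ f.kind = .inner) ∨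
    (e = S.root ∧ f.vertex = none ∧ f.kind = .bottom none)

theorem exists_isUpperSection : ∃ f : (S.degen e).Face, IsUpperSection f := by
  by_cases h : ∃ w, S.out w = e
  · obtain ⟨w, hw⟩ := h
    obtain ⟨f, hf⟩ := Face.exists_of_isFace (T := S.degen e) (w := some w) (k := .inner)
      (fun h => Option.some_ne_none S.root ((degen_out_some_of_eq hw).symm.trans h).symm)
    exact ⟨f, Or.inl ⟨w, hw, hf⟩⟩
  · obtain ⟨f, hf⟩ := Face.exists_of_isFace (T := S.degen e) (w := none) (k := .top) <| by
      rintro a rfl (_ | v) hv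
      · exact Option.some_ne_none e hv
      · exact h ⟨v, degen_out_some_eq_none_iff.1 hv⟩
    exact ⟨f, Or.inr ⟨fun w hw => h ⟨w, hw⟩, hf⟩⟩

theorem exists_isLowerSection : ∃ f : (S.degen e).Face, IsLowerSection f := by
  by_cases h : e = S.root
  · obtain ⟨f, hf⟩ := Face.exists_of_isFace (T := S.degen e) (w := none) (k := .bottom none)
      ⟨congrArg some h, rfl, fun a ha ha' => absurd ha ha'⟩
    exact ⟨f, Or.inr ⟨h, hf⟩⟩
  · obtain ⟨f, hf⟩ := Face.exists_of_isFace (T := S.degen e) (w := none) (k := .inner)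
      (fun h' => h (Option.some.inj h'))
    exact ⟨f, Or.inl ⟨h, hf⟩⟩

theorem IsUpperSection.eq {f g : (S.degen e).Face} (hf : IsUpperSection f)
    (hg : IsUpperSection g) : f = g := by
  rcases hf with ⟨w, hw, h1, h2⟩ | ⟨h, h1, h2⟩ <;> rcases hg with ⟨w', hw', h3, h4⟩ | ⟨h', h3, h4⟩
  · obtain rfl := S.out_inj (hw.trans hw'.symm)
    exact Face.ext_vertex_kind (h1.trans h3.symm) (h2.trans h4.symm)
  · exact absurd hw (h' w)
  · exact absurd hw' (h w')
  · exact Face.ext_vertex_kind (h1.trans h3.symm) (h2.trans h4.symm)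

theorem IsLowerSection.eq {f g : (S.degen e).Face} (hf : IsLowerSection f)
    (hg : IsLowerSection g) : f = g := by
  rcases hf with ⟨h, h1, h2⟩ | ⟨h, h1, h2⟩ <;> rcases hg with ⟨h', h3, h4⟩ | ⟨h', h3, h4⟩
  · exact Face.ext_vertex_kind (h1.trans h3.symm) (h2.trans h4.symm)
  · exact absurd h' h
  · exact absurd h h'
  · exact Face.ext_vertex_kind (h1.trans h3.symm) (h2.trans h4.symm)

theorem IsUpperSection.removedEdges {f : (S.degen e).Face} (hf : IsUpperSection f) :
    (S.degen e).removedEdges f.vertex f.kind = {none} := by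
  rcases hf with ⟨w, hw, h1, h2⟩ | ⟨h, h1, h2⟩ <;> rw [h1, h2]
  · exact congrArg (fun a => ({a} : Set (S.degen e).Edge)) (degen_out_some_of_eq hw)
  · rfl

theorem IsLowerSection.removedEdges {f : (S.degen e).Face} (hf : IsLowerSection f) :
    (S.degen e).removedEdges f.vertex f.kind = {some e} := by
  rcases hf with ⟨h, h1, h2⟩ | ⟨h, h1, h2⟩ <;> rw [h1, h2]
  · rfl
  · change insert (some e) (({none} : Set (Option S.Edge)) \ {none}) = {some e}
    rw [Set.sdiff_self]
    exact insert_empty_eq _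

/-- The degeneracy map identifies only `e` with its copy, and each of the two faces has lost one of
them. -/
theorem section_injective {f : (S.degen e).Face} (hf : IsUpperSection f ∨ IsLowerSection f) :
    Function.Injective (edgeMap (f.incl ≫ S.degenMap e)) := by
  intro a b hab
  apply f.incl_injective
  have hr := hf.imp IsUpperSection.removedEdges IsLowerSection.removedEdges
  have hm : ∀ c, edgeMap f.incl c ∉ (S.degen e).removedEdges f.vertex f.kind := fun c => by
    have h : edgeMap f.incl c ∈ Set.range (edgeMap f.incl) := ⟨c, rfl⟩
    rwa [f.range_incl] at h
  have ha := hm a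
  have hb := hm b
  rw [edgeMap_comp, edgeMap_comp] at hab
  generalize edgeMap f.incl a = a' at *
  generalize edgeMap f.incl b = b' at *
  cases a' with
  | none =>
    cases b' with
    | none => rfl
    | some b' =>
      have hab : e = b' := hab
      subst hab
      rcases hr with hr | hr
      · exact absurd (hr ▸ rfl) ha
      · exact absurd (hr ▸ rfl) hb
  | some a' =>
    cases b' with
    | none =>
      have hab : a' = e := hab
      subst hab
      rcases hr with hr | hr
      · exact absurd (hr ▸ rfl) hb
      · exact absurd (hr ▸ rfl) ha
    | some b' => exact congrArg some hab

theorem section_surjective {f : (S.degen e).Face} (hf : IsUpperSection f ∨ IsLowerSection f) :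
    Function.Surjective (edgeMap (f.incl ≫ S.degenMap e)) := by
  have hm : ∀ c, c ∉ (S.degen e).removedEdges f.vertex f.kind → ∃ b, edgeMap f.incl b = c := by
    intro c hc
    have h : c ∈ Set.range (edgeMap f.incl) := f.range_incl ▸ hc
    exact h
  intro s
  rcases hf with hf | hf
  · obtain ⟨b, hb⟩ := hm (some s) (by rw [hf.removedEdges]; exact Option.some_ne_none s)
    exact ⟨b, by rw [edgeMap_comp, hb]; rfl⟩
  · by_cases hs : s = e
    · obtain ⟨b, hb⟩ := hm none
        (by rw [hf.removedEdges]; exact (Option.some_ne_none e).symm)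
      exact ⟨b, by rw [edgeMap_comp, hb]; exact hs.symm⟩
    · obtain ⟨b, hb⟩ := hm (some s)
        (by rw [hf.removedEdges]; exact fun h => hs (Option.some.inj h))
      exact ⟨b, by rw [edgeMap_comp, hb]; rfl⟩

theorem range_out_section {f : (S.degen e).Face} (hf : IsUpperSection f ∨ IsLowerSection f) :
    Set.range (fun v => edgeMap (f.incl ≫ S.degenMap e) (f.tree.out v)) = Set.range S.out := by
  change Set.range (edgeMap (S.degenMap e) ∘ fun v => edgeMap f.incl (f.tree.out v)) = _
  rw [Set.range_comp, f.range_out_incl, Set.image_image]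
  -- Either the unary vertex is left out, or the vertex `w` above it; in the latter case the unary
  -- vertex takes over the output `e`.
  have hv : f.vertex = none ∨ ∃ w, S.out w = e ∧ f.vertex = some w := by
    rcases hf with (⟨w, hw, h, -⟩ | ⟨-, h, -⟩) | (⟨-, h, -⟩ | ⟨-, h, -⟩)
    exacts [Or.inr ⟨w, hw, h⟩, Or.inl h, Or.inl h, Or.inl h]
  ext s
  rcases hv with hv | ⟨w, hw, hv⟩ <;> rw [hv]
  · constructor
    · rintro ⟨x, hx, rfl⟩
      cases x with
      | none => exact absurd rfl hx
      | some x => exact ⟨x, (edgeMap_degenMap_out_some x).symm⟩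
    · rintro ⟨x, rfl⟩
      exact ⟨some x, Option.some_ne_none x, edgeMap_degenMap_out_some x⟩
  · constructor
    · rintro ⟨x, hx, rfl⟩
      cases x with
      | none => exact ⟨w, hw⟩
      | some x => exact ⟨x, (edgeMap_degenMap_out_some x).symm⟩
    · rintro ⟨x, rfl⟩
      by_cases hx : x = w
      · subst hx
        exact ⟨none, (Option.some_ne_none x).symm, hw.symm⟩
      · exact ⟨some x, fun h => hx (Option.some.inj h), edgeMap_degenMap_out_some x⟩

/-- The lower section has the sign given by the label of the unary vertex. The upper one is either
inner, at a vertex with the next label, or a top face at the unary vertex itself, whose kind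
contributes `-1`. -/
theorem sgn_upperSection {f g : (S.degen e).Face} (hf : IsUpperSection f)
    (hg : IsLowerSection g) : f.sgn p = - g.sgn p := by
  have h : g.sgn p = (-1) ^ p.label none := by
    rw [Face.sgn_eq]
    rcases hg with ⟨-, h1, h2⟩ | ⟨-, h1, h2⟩ <;> rw [h1, h2] <;> exact one_mul _
  rw [h, Face.sgn_eq]
  rcases hf with ⟨w, hw, h1, h2⟩ | ⟨-, h1, h2⟩ <;> rw [h1, h2]
  · rw [label_eq_label_none_add_one p hw, pow_succ]
    simp [FaceKind.sgn]
  · simp [FaceKind.sgn]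

/-! ### The other faces -/

/-- The other faces of `σ_e S` are given by faces of `S`. -/
theorem exists_face_of_not_section {f : (S.degen e).Face} (h1 : ¬ IsUpperSection f)
    (h2 : ¬ IsLowerSection f) : ∃ f₀ : S.Face, f.vertex = some f₀.vertex ∧
      f.kind = f₀.kind.map some ∧ (f₀.kind = .inner → S.out f₀.vertex ≠ e) := by
  have hf := f.isFace
  generalize hv : f.vertex = v at hf
  generalize hk : f.kind = k at hf
  cases v with
  | none =>
    exfalso
    cases k with
    | inner => exact h2 (Or.inl ⟨fun h => hf (congrArg some h), hv, hk⟩)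
    | top => exact h1 (Or.inr ⟨fun w hw => hf none rfl (some w) (degen_out_some_of_eq hw), hv, hk⟩)
    | bottom a =>
      obtain rfl : a = none := hf.2.1
      exact h2 (Or.inr ⟨Option.some.inj hf.1, hv, hk⟩)
  | some w =>
    have hleaf : ∀ a, (S.degen e).IsLeaf (some a) → S.IsLeaf a := by
      rintro a ha u rfl
      by_cases hu : S.out u = e
      · exact ha none (congrArg some hu.symm)
      · exact ha (some u) (degen_out_some_of_ne hu)
    cases k with
    | inner =>
      have hwe : S.out w ≠ e := fun h => h1 (Or.inl ⟨w, h, hv, hk⟩)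
      obtain ⟨f₀, h3, h4⟩ := Face.exists_of_isFace (T := S) (w := w) (k := .inner)
        (fun h => hf ((degen_out_some_of_ne hwe).trans (congrArg some h)))
      exact ⟨f₀, by rw [h3], by rw [h4]; rfl, fun _ => h3 ▸ hwe⟩
    | top =>
      obtain ⟨f₀, h3, h4⟩ := Face.exists_of_isFace (T := S) (w := w) (k := .top)
        (fun a ha => hleaf a (hf _ (some_mem_degen_ins.2 ha)))
      exact ⟨f₀, by rw [h3], by rw [h4]; rfl, fun h => by rw [h4] at h; cases h⟩
    | bottom a =>
      obtain ⟨hr, ⟨a, ha, rfl⟩, hl⟩ := hf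
      obtain ⟨f₀, h3, h4⟩ := Face.exists_of_isFace (T := S) (w := w) (k := .bottom a)
        ⟨(degen_out_some_eq_some_iff.1 hr).1, ha, fun b hb hba =>
          hleaf b (hl _ (some_mem_degen_ins.2 hb) (fun h => hba (Option.some.inj h)))⟩
      exact ⟨f₀, by rw [h3], by rw [h4]; rfl, fun h => by rw [h4] at h; cases h⟩

/-- In `σ_e S` the edge `e` is the output of the unary vertex, hence not a leaf, and is never
chopped off as an input; it is not a contracted edge by `hi`. For a bottom face `e` is not the root
either, as the root would then be the output of the unary vertex. -/
theorem removedEdges_degen {f : (S.degen e).Face} {f₀ : S.Face}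
    (hv : f.vertex = some f₀.vertex) (hk : f.kind = f₀.kind.map some)
    (hi : f₀.kind = .inner → S.out f₀.vertex ≠ e) :
    (S.degen e).removedEdges f.vertex f.kind = some '' S.removedEdges f₀.vertex f₀.kind ∧
      e ∉ S.removedEdges f₀.vertex f₀.kind := by
  have hf := f.isFace
  rw [hv, hk] at hf ⊢
  generalize f₀.kind = k at *
  generalize f₀.vertex = w at *
  have hleaf : ¬ (S.degen e).IsLeaf (some e) := fun h => h none rfl
  cases k with
  | inner =>
    refine ⟨?_, fun h => hi rfl h.symm⟩
    exact (congrArg _ (degen_out_some_of_ne (hi rfl))).trans Set.image_singleton.symm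
  | top => exact ⟨rfl, fun h => hleaf (hf _ (some_mem_degen_ins.2 h))⟩
  | bottom a =>
    obtain ⟨hr, -, hl⟩ := hf
    obtain ⟨h1, h2⟩ := degen_out_some_eq_some_iff.1 hr
    constructor
    · change insert ((S.degen e).out (some w)) ((some '' S.ins w) \ {some a}) =
        some '' (insert (S.out w) (S.ins w \ {a}))
      rw [degen_out_some_of_ne (h1.trans_ne h2), Set.image_insert_eq,
        Set.image_sdiff (Option.some_injective _), Set.image_singleton]
      rfl
    · rintro (h | h)
      · exact h2 (h1.symm.trans h.symm)
      · exact hleaf (hl _ (some_mem_degen_ins.2 h.1) (fun h' => h.2 (Option.some.inj h')))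

/-- The other faces of `σ_e S` are of the form `σ_{e'} S'` for a face `S'` of `S`. -/
theorem exists_iso_degen_face {f : (S.degen e).Face} (h1 : ¬ IsUpperSection f)
    (h2 : ¬ IsLowerSection f) : ∃ (f₀ : S.Face) (e₀ : f₀.tree.Edge)
      (α : f.tree ≅ f₀.tree.degen e₀),
      f.incl ≫ S.degenMap e = (α.hom ≫ f₀.tree.degenMap e₀) ≫ f₀.incl := by
  obtain ⟨f₀, hv, hk, hi⟩ := exists_face_of_not_section h1 h2
  obtain ⟨hr, he⟩ := removedEdges_degen hv hk hi
  obtain ⟨e₀, he₀⟩ : e ∈ Set.range (edgeMap f₀.incl) := f₀.range_incl ▸ he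
  have hinj := f₀.incl_injective
  -- Only a map on edges, not known to come from a morphism; the comparison of embeddings requires
  -- just that it reflects the order and has the right range and outputs.
  let ψ : (f₀.tree.degen e₀).Edge → (S.degen e).Edge := Option.map (edgeMap f₀.incl)
  have hψ : Function.Injective ψ := Option.map_injective hinj
  have hb : ∀ a b, (S.degen e).Below (ψ a) (ψ b) ↔ (f₀.tree.degen e₀).Below a b := by
    intro a b
    cases a with
    | none =>
      cases b with
      | none => exact ⟨fun _ => below_refl _, fun _ => below_refl _⟩
      | some b =>
        refine degen_below_none_some.trans (Iff.trans ?_ degen_below_none_some.symm)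
        rw [← he₀, below_edgeMap_iff hinj, hinj.ne_iff]
    | some a =>
      cases b with
      | none =>
        refine degen_below_some_none.trans (Iff.trans ?_ degen_below_some_none.symm)
        rw [← he₀, below_edgeMap_iff hinj]
      | some b =>
        exact degen_below_some_some.trans
          ((below_edgeMap_iff hinj).trans degen_below_some_some.symm)
  have hrange : Set.range (edgeMap f.incl) = Set.range ψ := by
    rw [f.range_incl, hr]
    ext a
    cases a with
    | none =>
      refine ⟨fun _ => ⟨none, rfl⟩, fun _ => ?_⟩
      rintro ⟨b, -, hb⟩
      exact Option.some_ne_none b hb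
    | some a =>
      have h : (some a : Option S.Edge) ∈ some '' S.removedEdges f₀.vertex f₀.kind ↔
          a ∈ S.removedEdges f₀.vertex f₀.kind := (Option.some_injective _).mem_set_image
      refine (not_congr h).trans ?_
      rw [← Set.mem_compl_iff, ← f₀.range_incl]
      constructor
      · rintro ⟨b, rfl⟩
        exact ⟨some b, rfl⟩
      · rintro ⟨_ | b, hb⟩
        · exact absurd hb.symm (Option.some_ne_none a)
        · exact ⟨b, Option.some.inj hb⟩
  have hψout : ∀ u, ψ ((f₀.tree.degen e₀).out u) = (S.degen e).out (Option.map f₀.vert u) := by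
    intro u
    cases u with
    | none => exact congrArg some he₀
    | some u =>
      by_cases hu : f₀.tree.out u = e₀
      · have hu' : S.out (f₀.vert u) = e := by rw [f₀.out_vert, hu, he₀]
        rw [degen_out_some_of_eq hu]
        exact (degen_out_some_of_eq hu').symm
      · have hu' : S.out (f₀.vert u) ≠ e := by rwa [f₀.out_vert, ← he₀, hinj.ne_iff]
        rw [degen_out_some_of_ne hu]
        refine Eq.trans ?_ (degen_out_some_of_ne hu').symm
        rw [f₀.out_vert]
        rfl
  have hout : Set.range (fun v => edgeMap f.incl (f.tree.out v)) =
      Set.range (fun v => ψ ((f₀.tree.degen e₀).out v)) := by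
    rw [f.range_out_incl, funext hψout]
    ext a
    constructor
    · rintro ⟨x, hx, rfl⟩
      rw [hv] at hx
      cases x with
      | none => exact ⟨none, rfl⟩
      | some x =>
        obtain ⟨u, rfl⟩ := f₀.exists_vert_eq (x := x) (fun h => hx (congrArg some h))
        exact ⟨some u, rfl⟩
    · rintro ⟨u, rfl⟩
      refine ⟨_, ?_, rfl⟩
      rw [hv]
      cases u with
      | none => exact (Option.some_ne_none f₀.vertex).symm
      | some u => exact fun h => f₀.vert_ne u (Option.some.inj h)
  obtain ⟨α, hα⟩ := exists_iso_of_embeddings f.incl_injective hψ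
    (fun _ _ => below_edgeMap_iff f.incl_injective) hb hrange hout
  refine ⟨f₀, e₀, α, hom_ext fun a => ?_⟩
  rw [edgeMap_comp, edgeMap_comp, edgeMap_comp, ← hα]
  generalize edgeMap α.hom a = b
  cases b with
  | none => exact he₀.symm
  | some b => rfl

end Degeneracy

theorem size_eq_of_iso {S T : Tree} (τ : S ≅ T) : S.size = T.size :=
  Nat.card_congr (Equiv.ofBijective _ ⟨vertMap_injective _ _, vertMap_iso_surjective τ⟩)

end Tree

/-! ### Faces of degenerate dendrices -/

open Dendroidal.Tree

variable {X : DendroidalSet.{u}}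

theorem cls_mem_D {n : ℕ} {g : PlanarDendrex X n} (h : IsDegenerate g.dendrex) :
    g.cls ∈ D X n := AddSubgroup.subset_closure ⟨g, h, rfl⟩

/-- The two faces differ as subtrees of `σ_e S` and are isomorphic only over `S`. The dendrices come
from `S`, and the planar structures agree because the left-right order does not see the difference
between `e` and its copy. -/
theorem cls_face_upperSection_eq {n : ℕ} {S : Tree} {e : S.Edge}
    (hn : (S.degen e).size = n + 1) (p : Planar (S.degen e)) (y : X.obj (Opposite.op S))
    {f g : (S.degen e).Face} (hf : IsUpperSection f) (hg : IsLowerSection g) :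
    (PlanarDendrex.face ⟨S.degen e, hn, p, DendroidalSet.restrict (S.degenMap e) y⟩ f).cls =
      (PlanarDendrex.face ⟨S.degen e, hn, p, DendroidalSet.restrict (S.degenMap e) y⟩ g).cls := by
  have hfi := section_injective (Or.inl hf)
  have hgi := section_injective (Or.inr hg)
  obtain ⟨α, hα⟩ := exists_iso_of_embeddings hfi hgi (fun _ _ => below_edgeMap_iff hfi)
    (fun _ _ => below_edgeMap_iff hgi)
    (by rw [(section_surjective (Or.inl hf)).range_eq, (section_surjective (Or.inr hg)).range_eq])
    (by rw [range_out_section (Or.inl hf), range_out_section (Or.inr hg)])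
  have hα' : (α.hom ≫ g.incl) ≫ S.degenMap e = f.incl ≫ S.degenMap e := hom_ext hα
  refine Eq.symm ((cls_iso _ (f.size_tree hn) _ α _).trans ?_)
  change PlanarDendrex.cls ⟨f.tree, _, _, _⟩ = PlanarDendrex.cls ⟨f.tree, _, _, _⟩
  rw [← Planar.pullback_comp, ← DendroidalSet.restrict_comp, ← DendroidalSet.restrict_comp,
    ← DendroidalSet.restrict_comp, hα', pullback_eq_of_comp_degenMap_eq p hα']

/-- The terms of the two sections cancel, and all other faces of `σ_e S` are degeneracies of faces
of `S`. -/
theorem faceSum_degen_mem_D {n : ℕ} {S : Tree} {e : S.Edge} (hn : (S.degen e).size = n + 1)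
    (p : Planar (S.degen e)) (y : X.obj (Opposite.op S)) :
    faceSum ⟨S.degen e, hn, p, DendroidalSet.restrict (S.degenMap e) y⟩ ∈ D X n := by
  classical
  obtain ⟨f, hf⟩ := exists_isUpperSection (S := S) (e := e)
  obtain ⟨g, hg⟩ := exists_isLowerSection (S := S) (e := e)
  have hfg : g ≠ f := by
    rintro rfl
    have h := hf.removedEdges.symm.trans hg.removedEdges
    exact Option.some_ne_none e (Set.singleton_injective h).symm
  rw [faceSum, ← Finset.add_sum_erase _ _ (Finset.mem_univ f),
    ← Finset.add_sum_erase _ _ (Finset.mem_erase.2 ⟨hfg, Finset.mem_univ g⟩), ← add_assoc]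
  refine add_mem ?_ (sum_mem fun f' hf' => AddSubgroup.zsmul_mem _ (cls_mem_D ?_) _)
  · rw [cls_face_upperSection_eq hn p y hf hg, ← add_smul]
    change (f.sgn p + g.sgn p) • _ ∈ _
    rw [sgn_upperSection p hf hg, neg_add_cancel, zero_smul]
    exact zero_mem _
  · rw [Finset.mem_erase, Finset.mem_erase] at hf'
    obtain ⟨f₀, e₀, α, hα⟩ := exists_iso_degen_face (f := f') (fun h => hf'.2.1 (h.eq hf))
      (fun h => hf'.1 (h.eq hg))
    refine ⟨f₀.tree, e₀, α, DendroidalSet.restrict f₀.incl y, ?_⟩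
    change DendroidalSet.restrict f'.incl (DendroidalSet.restrict (S.degenMap e) y) = _
    rw [← DendroidalSet.restrict_comp, ← DendroidalSet.restrict_comp, hα]
    rfl

theorem faceSum_mem_D {n : ℕ} {g : PlanarDendrex X (n + 1)} (h : IsDegenerate g.dendrex) :
    faceSum g ∈ D X n := by
  obtain ⟨T, hT, p, x⟩ := g
  obtain ⟨S, e, (α : T ≅ S.degen e), y,
    (rfl : x = DendroidalSet.restrict (α.hom ≫ S.degenMap e) y)⟩ := h
  have hn : (S.degen e).size = n + 1 := (size_eq_of_iso α).symm.trans hT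
  -- Invariance under isomorphisms allows the tree to be replaced by `σ_e S` itself.
  rw [faceSum_iso hT hn p α.symm, Iso.symm_hom, ← DendroidalSet.restrict_comp,
    α.inv_hom_id_assoc]
  exact faceSum_degen_mem_D hn _ y

theorem IsFaceDifferential.map_mem_D {d : ∀ n : ℕ, Chun X (n + 1) →+ Chun X n}
    (hd : IsFaceDifferential X d) (n : ℕ) : ∀ y ∈ D X (n + 1), d n y ∈ D X n := by
  suffices h : D X (n + 1) ≤ (D X n).comap (d n) from h
  rw [D, AddSubgroup.closure_le]
  rintro _ ⟨g, hg, rfl⟩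
  rw [SetLike.mem_coe, AddSubgroup.mem_comap, hd]
  exact faceSum_mem_D hg

end Dendroidal

/-! ### The proposition -/

theorem proposition4p3 (X : Dendroidal.DendroidalSet.{u}) :
    (∃! d : ∀ n : ℕ, Dendroidal.Chun X (n + 1) →+ Dendroidal.Chun X n,
      Dendroidal.IsFaceDifferential X d) ∧
    ∀ d : ∀ n : ℕ, Dendroidal.Chun X (n + 1) →+ Dendroidal.Chun X n,
      Dendroidal.IsFaceDifferential X d →
        (∀ n : ℕ, (d n).comp (d (n + 1)) = 0) ∧
        ∀ n : ℕ, ∀ y ∈ Dendroidal.D X (n + 1), d n y ∈ Dendroidal.D X n := by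
  refine ⟨⟨Dendroidal.differential X, Dendroidal.isFaceDifferential_differential X,
    fun d hd => funext fun n => Dendroidal.chun_hom_ext fun g => ?_⟩,
    fun d hd => ⟨hd.comp_eq_zero, hd.map_mem_D⟩⟩
  rw [hd, Dendroidal.isFaceDifferential_differential X]
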